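/- Let $\Gamma$ be a torsion-free abelian group and let $\mathsf{E}=\bigoplus_{\gamma\in\Gamma}\mathsf{E}_\gamma$ be a graded division ring (a nonzero graded ring in which every nonzero homogeneous element is invertible) that is finite-dimensional over its center $\mathsf{T}$, with index $n$, i.e. $[\mathsf{E}:\mathsf{T}]=n^2$. Let $\tau$ be a unitary graded involution on $\mathsf{E}$, i.e. an anti-automorphism with $\tau^2=\mathrm{id}$, $\tau(\mathsf{E}_\gamma)=\mathsf{E}_\gamma$ for all $\gamma$, and $\tau|_{\mathsf{T}}\neq \mathrm{id}$, and let $\mathsf{R}=\mathsf{T}^\tau$. Write $\Gamma_{\mathsf S}=\{\gamma\mid \mathsf S\cap\mathsf E_\gamma\ne0\}$ for a graded subring $\mathsf S$ of $\mathsf{E}$; $\mathsf{E}'=[\mathsf{E}^*,\mathsf{E}^*]$; $a^{1-\tau}=a\,\tau(a)^{-1}$; $\mathrm{Nrd}_{\mathsf E}$ for the restriction to $\mathsf{E}$ of the reduced norm of the quotient division ring $\mathsf{E}\otimes_{\mathsf T}q(\mathsf T)$, where $q(\mathsf{T})$ is the quotient field of $\mathsf{T}$; and $$\mathsf{E}^{(1)}=\{a\in\mathsf{E}^*\mid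 \mathrm{Nrd}_{\mathsf E}(a)=1\},\qquad \Sigma_\tau=\langle a\in\mathsf{E}^*\mid\tau(a)=a\rangle,\qquad \Sigma'_\tau=\{a\in\mathsf{E}^*\mid \mathrm{Nrd}_{\mathsf E}(a^{1-\tau})=1\},$$ $$K_1(\mathsf{E})=\mathsf{E}^*/\mathsf{E}',\quad SK_1(\mathsf{E})=\mathsf{E}^{(1)}/\mathsf{E}',\quad K_1(\mathsf{E},\tau)=\mathsf{E}^*/(\Sigma_\tau\mathsf{E}'),\quad SK_1(\mathsf{E},\tau)=\Sigma'_\tau/(\Sigma_\tau\mathsf{E}').$$ Let $\mu_k$ be the group of $k$-th roots of unity in an algebraic closure of $\mathsf{T}_0$, and $\mu_k(\mathsf{T}_0)=\mu_k\cap\mathsf{T}_0^*$. Suppose that $\mathsf{E}$ is totally ramified over $\mathsf{T}$ (i.e. $\mathsf{E}_0=\mathsf{T}_0$) and that $\mathsf{T}$ is unramified over $\mathsf{R}$ (i.e. $\Gamma_{\mathsf T}=\Gamma_{\mathsf R}$), and let $e$ be the exponent of $\Gamma_{\mathsf E}/\Gamma_{\mathsf T}$. Then $\{a\in\mathsf{T}_0^*\mid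 a^e\in\mathsf{R}_0^*\}\subseteq\{a\in\mathsf{T}_0^*\mid a^n\in\mathsf{R}_0^*\}$, $\mu_e\subseteq\mathsf{T}_0^*$, $\mu_e\subseteq\{\omega\in\mu_n(\mathsf{T}_0)\mid\tau(\omega)=\omega^{-1}\}$, and $$SK_1(\mathsf{E},\tau)\;\cong\;\{a\in\mathsf{T}_0^*\mid a^n\in\mathsf{R}_0^*\}\big/\{a\in\mathsf{T}_0^*\mid a^e\in\mathsf{R}_0^*\}\;\cong\;\{\omega\in\mu_n(\mathsf{T}_0)\mid\tau(\omega)=\omega^{-1}\}\big/\mu_e .$$ Moreover: (i) $SK_1(\mathsf{E})\cong\mu_n(\mathsf{T}_0)/\mu_e$, and the map $K_1(\mathsf{E},\tau)\to K_1(\mathsf{E})$, $a\,\Sigma_\tau\mathsf{E}'\mapsto a^{1-\tau}\mathsf{E}'$, is a well-defined homomorphism whose restriction is an injective homomorphism $\alpha\colon SK_1(\mathsf{E},\tau)\to SK_1(\mathsf{E})$. (ii) If $e$ is odd, then $\alpha$ is an isomorphism. (iii) If $e>2$, then $\mathsf{T}_0=\mathsf{R}_0(\mu_e)$, and $\tau$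 acts on $\mu_e$ by $\omega\mapsto\omega^{-1}$. -/

import Mathlib

open scoped TensorProduct Polynomial

universe u v

noncomputable section

namespace GradedSK

/-! ### The reduced norm of a central simple algebra -/

section ReducedNorm

variable (K : Type u) [Field K] (A : Type v) [Ring A] [Algebra K A]

/-- `A` is split by the algebraic closure of `K` as a matrix algebra. This holds for every central
simple `K`-algebra of finite dimension. -/
def HasSplitting : Prop :=
  ∃ m : ℕ, Nonempty
    ((AlgebraicClosure K ⊗[K] A) ≃ₐ[AlgebraicClosure K]
      Matrix (Fin m) (Fin m) (AlgebraicClosure K))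

open Classical in
/-- The reduced norm of a central simple `K`-algebra `A`: the determinant of the image of `1 ⊗ a`
under an isomorphism of `K^alg ⊗ A` with a full matrix algebra over `K^alg`. (By the Skolem-Noether
theorem the result does not depend on the isomorphism. Its values lie in `K`; they are recorded
here as elements of the algebraic closure `K^alg`.) -/
def reducedNorm : A →* AlgebraicClosure K :=
  if h : HasSplitting K A then
    { toFun := fun a => Matrix.det (h.choose_spec.some ((1 : AlgebraicClosure K) ⊗ₜ[K] a))
      map_one' := by rw [← Algebra.TensorProduct.one_def, map_one, Matrix.det_one]
      map_mul' := fun a b => by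
        rw [← Matrix.det_mul, ← map_mul, Algebra.TensorProduct.tmul_mul_tmul, one_mul] }
  else 1

end ReducedNorm

/-! ### Graded division rings -/

section Graded

variable {Γ : Type v} [AddCommGroup Γ] [DecidableEq Γ] {E : Type u} [Ring E]

/-- The grade set `Γ_S = {γ | S ∩ E_γ ≠ 0}` of a subset `S` of a graded ring `E`. -/
def gradeSet (𝒜 : Γ → AddSubgroup E) (S : Set E) : Set Γ :=
  {γ | ∃ a ∈ S, a ≠ 0 ∧ a ∈ 𝒜 γ}

/-- The grade group: the subgroup generated by the grade set. (For the graded division ring `E`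
and its graded subfields the grade set already is a group.) -/
def gradeGroup (𝒜 : Γ → AddSubgroup E) (S : Set E) : AddSubgroup Γ :=
  AddSubgroup.closure (gradeSet 𝒜 S)

/-- The quotient `Γ_E / Γ_T`, where `T` is the center of `E`. -/
abbrev RelativeGradeGroup (𝒜 : Γ → AddSubgroup E) : Type v :=
  gradeGroup 𝒜 (Set.univ : Set E) ⧸
    (gradeGroup 𝒜 (Subring.center E : Set E)).addSubgroupOf (gradeGroup 𝒜 (Set.univ : Set E))

variable (𝒜 : Γ → AddSubgroup E) [GradedRing 𝒜]

/-- A graded ring is a graded division ring if it is nonzero and all its nonzero homogeneous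
elements are invertible. (The grading group is required to be torsion-free separately.) -/
class IsGradedDivisionRing : Prop where
  nontrivial : Nontrivial E
  isUnit_of_mem : ∀ {γ : Γ} {a : E}, a ∈ 𝒜 γ → a ≠ 0 → IsUnit a

/-- A homogeneous involution: the anti-automorphism `star` of `E` of order dividing two preserves
each homogeneous component. -/
class IsGradedInvolution [StarRing E] : Prop where
  star_mem : ∀ {γ : Γ} {a : E}, a ∈ 𝒜 γ → star a ∈ 𝒜 γ

/-- `E` is totally ramified over its center `T`: `E_0 = T_0`. -/
def IsTotallyRamified : Prop :=
  ∀ a ∈ 𝒜 0, a ∈ Subring.center E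

theorem uniqueAdd_of_torsionFree [IsAddTorsionFree Γ] (A B : Finset Γ) (hA : A.Nonempty)
    (hB : B.Nonempty) : ∃ a ∈ A, ∃ b ∈ B, UniqueAdd A B a b := by
  classical
  let H : AddSubgroup Γ := AddSubgroup.closure ((A ∪ B : Finset Γ) : Set Γ)
  have hAH : ∀ a ∈ A, a ∈ H := fun a ha =>
    AddSubgroup.subset_closure (by simp [ha])
  have hBH : ∀ b ∈ B, b ∈ H := fun b hb =>
    AddSubgroup.subset_closure (by simp [hb])
  have : AddGroup.FG H := (AddGroup.fg_iff_addSubgroup_fg H).2 ⟨A ∪ B, rfl⟩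
  have : AddMonoid.FG H := AddGroup.fg_iff_addMonoid_fg.1 inferInstance
  have : TwoUniqueSums H := inferInstance
  have : UniqueSums H := inferInstance
  have hA' : (A.subtype (· ∈ H)).Nonempty := by
    obtain ⟨a, ha⟩ := hA
    exact ⟨⟨a, hAH a ha⟩, by simpa using ha⟩
  have hB' : (B.subtype (· ∈ H)).Nonempty := by
    obtain ⟨b, hb⟩ := hB
    exact ⟨⟨b, hBH b hb⟩, by simpa using hb⟩
  obtain ⟨a, ha, b, hb, h⟩ := UniqueSums.uniqueAdd_of_nonempty hA' hB'
  refine ⟨a, by simpa using ha, b, by simpa using hb, fun x y hx hy hxy => ?_⟩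
  have := @h ⟨x, hAH x hx⟩ ⟨y, hBH y hy⟩ (by simpa using hx) (by simpa using hy)
    (Subtype.ext hxy)
  exact ⟨congrArg Subtype.val this.1, congrArg Subtype.val this.2⟩

open DirectSum in
/-- A graded division ring with torsion-free grading group has no zero divisors. -/
theorem isDomain [IsAddTorsionFree Γ] [hE : IsGradedDivisionRing 𝒜] : IsDomain E := by
  classical
  have := hE.nontrivial
  have : NoZeroDivisors E := by
    refine ⟨fun {x y} hxy => ?_⟩
    by_contra! hne
    obtain ⟨hx, hy⟩ := hne
    have key : ∀ z : E, z ≠ 0 → (decompose 𝒜 z).support.Nonempty := by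
      intro z hz
      rw [Finset.nonempty_iff_ne_empty]
      intro h
      apply hz
      have : decompose 𝒜 z = 0 := by rwa [← DFinsupp.support_eq_empty]
      exact (DirectSum.decompose 𝒜).injective (by rw [this, DirectSum.decompose_zero])
    obtain ⟨a, ha, b, hb, hab⟩ := uniqueAdd_of_torsionFree _ _ (key x hx) (key y hy)
    have h1 : ((decompose 𝒜 (x * y)) (a + b) : E) = 0 := by simp [hxy]
    rw [DirectSum.decompose_mul, DirectSum.coe_mul_apply] at h1
    rw [Finset.sum_eq_single (a, b)] at h1
    · have hxa : ((decompose 𝒜 x) a : E) ≠ 0 := by simpa using ha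
      have hyb : ((decompose 𝒜 y) b : E) ≠ 0 := by simpa using hb
      have hu := hE.isUnit_of_mem ((decompose 𝒜 x) a).2 hxa
      exact hyb (hu.mul_right_eq_zero.1 h1)
    · rintro ⟨c, d⟩ hcd hne
      simp only [Finset.mem_filter, Finset.mem_product] at hcd
      obtain ⟨h1, h2⟩ := hab hcd.1.1 hcd.1.2 hcd.2
      exact absurd (Prod.ext h1 h2) hne
    · intro h
      exact (h (Finset.mem_filter.2 ⟨Finset.mem_product.2 ⟨ha, hb⟩, rfl⟩)).elim
  exact NoZeroDivisors.to_isDomain E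

/-- The quotient field `q(T)` of the center `T` of a graded division ring. -/
@[nolint unusedArguments]
def CenterQuotientField (_𝒜 : Γ → AddSubgroup E) : Type u := FractionRing (Subring.center E)

instance [IsAddTorsionFree Γ] [IsGradedDivisionRing 𝒜] : Field (CenterQuotientField 𝒜) :=
  haveI : IsDomain E := isDomain 𝒜
  inferInstanceAs (Field (FractionRing (Subring.center E)))

instance [IsAddTorsionFree Γ] [IsGradedDivisionRing 𝒜] :
    Algebra (Subring.center E) (CenterQuotientField 𝒜) :=
  inferInstanceAs (Algebra (Subring.center E) (FractionRing (Subring.center E)))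

instance [IsAddTorsionFree Γ] [IsGradedDivisionRing 𝒜] :
    IsFractionRing (Subring.center E) (CenterQuotientField 𝒜) :=
  inferInstanceAs (IsFractionRing (Subring.center E) (FractionRing (Subring.center E)))

/-- The quotient division ring `q(E) = q(T) ⊗_T E` of a graded division ring `E` with center `T`
over which it is finite-dimensional. -/
abbrev QuotientDivisionRing [IsAddTorsionFree Γ] [IsGradedDivisionRing 𝒜] : Type u :=
  CenterQuotientField 𝒜 ⊗[Subring.center E] E

/-- The reduced norm `Nrd_E`, i.e. the restriction to `E` of the reduced norm of `q(E)`. -/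
def nrd [IsAddTorsionFree Γ] [IsGradedDivisionRing 𝒜] :
    E →* AlgebraicClosure (CenterQuotientField 𝒜) :=
  (reducedNorm (CenterQuotientField 𝒜) (QuotientDivisionRing 𝒜)).comp
    ((Algebra.TensorProduct.includeRight :
      E →ₐ[Subring.center E] QuotientDivisionRing 𝒜) : E →* QuotientDivisionRing 𝒜)

/-! ### The Whitehead groups -/

variable (E) in
/-- `K_1(E) = E^* / E'`, with `E' = [E^*, E^*]`. -/
abbrev K1 : Type u := Eˣ ⧸ commutator Eˣ

/-- `E^(1)`, the group of units of `E` of reduced norm one. -/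
def unitsNrdOne [IsAddTorsionFree Γ] [IsGradedDivisionRing 𝒜] : Subgroup Eˣ where
  carrier := {a | nrd 𝒜 (a : E) = 1}
  one_mem' := by simp
  mul_mem' := by
    intro a b ha hb
    simp only [Set.mem_ofPred_eq] at ha hb ⊢
    simp [ha, hb]
  inv_mem' := by
    intro a ha
    simp only [Set.mem_ofPred_eq] at ha ⊢
    have h : nrd 𝒜 (a : E) * nrd 𝒜 ((a⁻¹ : Eˣ) : E) = 1 := by rw [← map_mul]; simp
    rwa [ha, one_mul] at h

/-- `SK_1(E) = E^(1) / E'`. -/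
abbrev SK1 [IsAddTorsionFree Γ] [IsGradedDivisionRing 𝒜] : Type u :=
  unitsNrdOne 𝒜 ⧸ (commutator Eˣ).subgroupOf (unitsNrdOne 𝒜)

section Unitary

variable [StarRing E]

variable (E) in
/-- `Σ_τ(E)`, the subgroup of `E^*` generated by the symmetric units. -/
def symmUnits : Subgroup Eˣ := Subgroup.closure {a : Eˣ | star a = a}

variable (E) in
/-- `Σ_τ(E) E'`. -/
def symmUnitsCommutator : Subgroup Eˣ := symmUnits E ⊔ commutator Eˣ

instance : (symmUnitsCommutator E).Normal :=
  Subgroup.Normal.of_commutator_le _ le_sup_right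

variable (E) in
/-- `K_1(E, τ) = E^* / (Σ_τ(E) E')`. -/
abbrev UnitaryK1 : Type u := Eˣ ⧸ symmUnitsCommutator E

/-- `a^(1-τ) = a τ(a)⁻¹`. -/
def oneSubTau (a : Eˣ) : Eˣ := a * (star a)⁻¹

/-- `Σ'_τ(E) = {a ∈ E^* | Nrd_E(a^(1-τ)) = 1}`. -/
def unitarySigma' [IsAddTorsionFree Γ] [IsGradedDivisionRing 𝒜] : Subgroup Eˣ where
  carrier := {a | oneSubTau a ∈ unitsNrdOne 𝒜}
  one_mem' := by simp [oneSubTau]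
  mul_mem' := by
    intro a b ha hb
    have ha : nrd 𝒜 ((a * (star a)⁻¹ : Eˣ) : E) = 1 := ha
    have hb : nrd 𝒜 ((b * (star b)⁻¹ : Eˣ) : E) = 1 := hb
    change nrd 𝒜 (((a * b) * (star (a * b))⁻¹ : Eˣ) : E) = 1
    simp only [star_mul, mul_inv_rev, Units.val_mul, map_mul] at ha hb ⊢
    calc _ = (nrd 𝒜 (a : E) * nrd 𝒜 (((star a)⁻¹ : Eˣ) : E)) *
          (nrd 𝒜 (b : E) * nrd 𝒜 (((star b)⁻¹ : Eˣ) : E)) := by ring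
      _ = 1 := by rw [ha, hb, one_mul]
  inv_mem' := by
    intro a ha
    have ha : nrd 𝒜 ((a * (star a)⁻¹ : Eˣ) : E) = 1 := ha
    change nrd 𝒜 ((a⁻¹ * (star a⁻¹)⁻¹ : Eˣ) : E) = 1
    have h : nrd 𝒜 ((a * (star a)⁻¹ : Eˣ) : E) * nrd 𝒜 ((a⁻¹ * (star a⁻¹)⁻¹ : Eˣ) : E) = 1 := by
      have h1 : nrd 𝒜 (a : E) * nrd 𝒜 ((a⁻¹ : Eˣ) : E) = 1 := by rw [← map_mul]; simp
      have h2 : nrd 𝒜 (((star a)⁻¹ : Eˣ) : E) * nrd 𝒜 ((star a : Eˣ) : E) = 1 := by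
        rw [← map_mul, ← Units.val_mul]; simp
      simp only [star_inv, inv_inv, Units.val_mul, map_mul]
      calc _ = (nrd 𝒜 (a : E) * nrd 𝒜 ((a⁻¹ : Eˣ) : E)) *
            (nrd 𝒜 (((star a)⁻¹ : Eˣ) : E) * nrd 𝒜 ((star a : Eˣ) : E)) := by ring
        _ = 1 := by rw [h1, h2, one_mul]
    rwa [ha, one_mul] at h

theorem oneSubTau_mem [IsAddTorsionFree Γ] [IsGradedDivisionRing 𝒜] (a : unitarySigma' 𝒜) :
    oneSubTau (a : Eˣ) ∈ unitsNrdOne 𝒜 := a.2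

/-- `SK_1(E, τ) = Σ'_τ(E) / (Σ_τ(E) E')`. -/
abbrev UnitarySK1 [IsAddTorsionFree Γ] [IsGradedDivisionRing 𝒜] : Type u :=
  unitarySigma' 𝒜 ⧸ (symmUnitsCommutator E).subgroupOf (unitarySigma' 𝒜)

variable (E) in
/-- `R = T^τ`, the subring of elements of the center `T` fixed by the involution. -/
def fixedCenter : Subring E where
  carrier := {a | a ∈ Subring.center E ∧ star a = a}
  one_mem' := ⟨one_mem _, star_one _⟩
  zero_mem' := ⟨zero_mem _, star_zero _⟩
  mul_mem' := fun {a b} ha hb => ⟨mul_mem ha.1 hb.1, by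
    rw [star_mul, ha.2, hb.2]; exact Subring.mem_center_iff.1 ha.1 b⟩
  add_mem' := fun ha hb => ⟨add_mem ha.1 hb.1, by rw [star_add, ha.2, hb.2]⟩
  neg_mem' := fun ha => ⟨neg_mem ha.1, by rw [star_neg, ha.2]⟩

variable (E) in
/-- The involution is unitary (of the second kind): it is not the identity on the center. -/
def IsUnitaryInvolution : Prop := ∃ t ∈ Subring.center E, star t ≠ t

/-- `T` is unramified over `R = T^τ`: `Γ_T = Γ_R`. -/
def CenterIsUnramified : Prop :=
  gradeSet 𝒜 (Subring.center E : Set E) = gradeSet 𝒜 (fixedCenter E : Set E)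

end Unitary

/-! ### The degree zero part of the center -/

/-- `T_0`, the degree zero part of the center `T` of `E`. -/
def centerZero : Subring E := Subring.center E ⊓ SetLike.GradeZero.subring 𝒜

instance : CommRing (centerZero 𝒜) :=
  { (inferInstance : Ring (centerZero 𝒜)) with
    mul_comm := fun a b => Subtype.ext (Subring.mem_center_iff.1 b.2.1 a) }

theorem isField_centerZero [hE : IsGradedDivisionRing 𝒜] : IsField (centerZero 𝒜) where
  exists_pair_ne := by
    have := hE.nontrivial
    exact ⟨0, 1, fun h => zero_ne_one (congrArg Subtype.val h)⟩
  mul_comm := mul_comm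
  mul_inv_cancel := by
    intro a ha
    have ha' : (a : E) ≠ 0 := fun h => ha (Subtype.ext h)
    obtain ⟨w, hw⟩ := hE.isUnit_of_mem (γ := 0) a.2.2 ha'
    have hc : ((w⁻¹ : Eˣ) : E) ∈ Subring.center E := by
      rw [Subring.mem_center_iff]
      intro g
      have hg : g * (w : E) = w * g := by
        rw [hw]; exact Subring.mem_center_iff.1 a.2.1 g
      calc g * ((w⁻¹ : Eˣ) : E) = ((w⁻¹ : Eˣ) : E) * (w * g) * ((w⁻¹ : Eˣ) : E) := by
            rw [← mul_assoc]; simp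
        _ = ((w⁻¹ : Eˣ) : E) * g := by rw [← hg]; simp [mul_assoc]
    have h0 : ((w⁻¹ : Eˣ) : E) ∈ 𝒜 0 := by
      have h1 : (w : E) * GradedRing.proj 𝒜 0 ((w⁻¹ : Eˣ) : E) = 1 := by
        have hw0 : (w : E) ∈ 𝒜 0 := by rw [hw]; exact a.2.2
        have h2 := DirectSum.coe_decompose_mul_add_of_left_mem 𝒜 (j := 0)
          (b := ((w⁻¹ : Eˣ) : E)) hw0
        rw [GradedRing.proj_apply, ← h2, Units.mul_inv, add_zero]
        exact DirectSum.decompose_of_mem_same 𝒜 SetLike.GradedOne.one_mem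
      have h3 : ((w⁻¹ : Eˣ) : E) = GradedRing.proj 𝒜 0 ((w⁻¹ : Eˣ) : E) := by
        calc ((w⁻¹ : Eˣ) : E)
            = ((w⁻¹ : Eˣ) : E) * ((w : E) * GradedRing.proj 𝒜 0 ((w⁻¹ : Eˣ) : E)) := by
              rw [h1, mul_one]
          _ = _ := by rw [Units.inv_mul_cancel_left]
      rw [h3, GradedRing.proj_apply]
      exact SetLike.coe_mem _
    exact ⟨⟨_, hc, h0⟩, Subtype.ext (by change (a : E) * _ = 1; rw [← hw]; simp)⟩

instance [IsGradedDivisionRing 𝒜] : Field (centerZero 𝒜) := (isField_centerZero 𝒜).toField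

section Involution

variable [StarRing E] [IsGradedInvolution 𝒜]

theorem star_mem_centerZero (a : centerZero 𝒜) : star (a : E) ∈ centerZero 𝒜 := by
  refine ⟨?_, IsGradedInvolution.star_mem (𝒜 := 𝒜) (γ := 0) a.2.2⟩
  rw [SetLike.mem_coe, Subring.mem_center_iff]
  intro g
  have h := congrArg star (Subring.mem_center_iff.1 a.2.1 (star g))
  simpa using h.symm

/-- The restriction of the involution to `T_0`. -/
instance : StarRing (centerZero 𝒜) where
  star a := ⟨star (a : E), star_mem_centerZero 𝒜 a⟩
  star_involutive _ := Subtype.ext (star_star _)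
  star_mul _ _ := Subtype.ext (star_mul _ _)
  star_add _ _ := Subtype.ext (star_add _ _)

variable [IsGradedDivisionRing 𝒜]

/-- `R_0 = {a ∈ T_0 | τ(a) = a}`, as a subfield of `T_0`. -/
def fixedZero : Subfield (centerZero 𝒜) where
  carrier := {a | star a = a}
  one_mem' := star_one _
  zero_mem' := star_zero _
  mul_mem' := fun {a b} ha hb => by
    simp only [Set.mem_ofPred_eq] at ha hb ⊢
    rw [star_mul', ha, hb]
  add_mem' := fun {a b} ha hb => by
    simp only [Set.mem_ofPred_eq] at ha hb ⊢
    rw [star_add, ha, hb]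
  neg_mem' := fun {a} ha => by
    simp only [Set.mem_ofPred_eq] at ha ⊢
    rw [star_neg, ha]
  inv_mem' := fun a ha => by
    simp only [Set.mem_ofPred_eq] at ha ⊢
    rw [star_inv₀, ha]

/-- The group `{a ∈ T_0^* | a^k ∈ R_0^*}`. -/
def powFixed (k : ℕ) : Subgroup (centerZero 𝒜)ˣ where
  carrier := {a | (a : centerZero 𝒜) ^ k ∈ fixedZero 𝒜}
  one_mem' := by simp [one_mem]
  mul_mem' := fun {a b} ha hb => by
    simp only [Set.mem_ofPred_eq, Units.val_mul, mul_pow] at ha hb ⊢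
    exact mul_mem ha hb
  inv_mem' := fun {a} ha => by
    simp only [Set.mem_ofPred_eq, Units.val_inv_eq_inv_val, inv_pow] at ha ⊢
    exact inv_mem ha

/-- The group `{ω ∈ μ_k(T_0) | τ(ω) = ω⁻¹}`. -/
def invertedRoots (k : ℕ) : Subgroup (centerZero 𝒜)ˣ where
  carrier := {ω | ω ∈ rootsOfUnity k (centerZero 𝒜) ∧ star ω = ω⁻¹}
  one_mem' := ⟨one_mem _, by simp⟩
  mul_mem' := fun ha hb => ⟨mul_mem ha.1 hb.1, by rw [star_mul, ha.2, hb.2, mul_inv_rev]⟩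
  inv_mem' := fun ha => ⟨inv_mem ha.1, by rw [star_inv, ha.2]⟩

end Involution

end Graded

end GradedSK

end

/-! Since `Γ` is torsion-free, every unit of `E` is homogeneous. Total ramification makes
degree-zero units central, so `T_0^*` is exactly the group of degree-zero units. Commutators have
degree zero, hence the commutator is a bimultiplicative pairing `β` on `E^*` with values in `T_0^*`,
nondegenerate on `E^*/Z(E^*) ≅ Γ_E/Γ_T`. Its values are exactly the `e`-th roots of unity, a
primitive one included, so `E' = μ_e`.

Coset representatives of `E^*/Z(E^*)` form a basis of `E` over `T`, so this quotient has order `n²`,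
and nondegeneracy of `β` gives `e ∣ n`. The reduced norm is `t ↦ t^n` on `T`; with torsion-freeness
this gives `E^(1) = μ_n(T_0)` and `SK_1(E) = μ_n(T_0)/μ_e`.

Because `Γ_T = Γ_R`, the involution moves some element of `T_0`. Hilbert 90 then writes each unit as
`t * s` with `t ∈ T_0^*` and `s` symmetric (`exists_eq_unitsInclusion_mul_symm`). Hence `T_0^*`
carries all of `SK_1(E, τ)`, and commutators of symmetric units already exhaust `μ_e`; this forces
`τ` to invert `μ_e` and puts every `t` with `t^(1-τ) ∈ μ_e` into `Σ_τ`
(`unitsInclusion_mem_symmUnits`). So `SK_1(E, τ)` is the quotient of the two groups of `t ∈ T_0^*`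
with `t^(1-τ)` in `μ_n` and in `μ_e`, and `t ↦ t^(1-τ)` maps it onto the inverted roots modulo
`μ_e`. -/

noncomputable section

namespace GradedSK

/-! ### Homogeneity and degrees of units. -/

section GradedUnits

open DirectSum

variable {Γ : Type v} [AddCommGroup Γ] [DecidableEq Γ] {E : Type u} [Ring E]
  (𝒜 : Γ → AddSubgroup E) [GradedRing 𝒜]

/-- Two uniquely attained sums, rather than one, are what exclude inhomogeneous units. -/
theorem twoUniqueSums_of_torsionFree [IsAddTorsionFree Γ] : TwoUniqueSums Γ :=
  haveI : UniqueSums Γ := ⟨fun {A B} hA hB => uniqueAdd_of_torsionFree A B hA hB⟩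
  UniqueSums.toTwoUniqueSums_of_addGroup

open Classical in
theorem decompose_support_nonempty {z : E} (hz : z ≠ 0) : (decompose 𝒜 z).support.Nonempty := by
  rw [Finset.nonempty_iff_ne_empty]
  intro h
  apply hz
  have : decompose 𝒜 z = 0 := by rwa [← DFinsupp.support_eq_empty]
  exact (decompose 𝒜).injective (by rw [this, decompose_zero])

theorem eq_of_mem_of_mem {a : E} (ha : a ≠ 0) {γ δ : Γ} (hγ : a ∈ 𝒜 γ) (hδ : a ∈ 𝒜 δ) :
    γ = δ := by
  by_contra hne
  exact ha ((decompose_of_mem_same 𝒜 hγ).symm.trans (decompose_of_mem_ne 𝒜 hδ (Ne.symm hne)))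

/-- For homogeneous `g` of degree `δ`, compare the components of degree `γ + δ` in `g * t = t * g`.
-/
theorem decompose_mem_center {t : E} (ht : t ∈ Subring.center E) (γ : Γ) :
    ((decompose 𝒜 t) γ : E) ∈ Subring.center E := by
  have key : ∀ δ, ∀ g ∈ 𝒜 δ, g * ((decompose 𝒜 t) γ : E) = (decompose 𝒜 t) γ * g := by
    intro δ g hg
    rw [← coe_decompose_mul_add_of_left_mem 𝒜 hg, ← coe_decompose_mul_add_of_right_mem 𝒜 hg,
      Subring.mem_center_iff.1 ht g, add_comm]
  rw [Subring.mem_center_iff]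
  intro g
  induction g using DirectSum.Decomposition.inductionOn 𝒜 with
  | zero => simp
  | homogeneous g => exact key _ _ g.2
  | add x y hx hy => rw [add_mul, mul_add, hx, hy]

variable [hE : IsGradedDivisionRing 𝒜]

open Classical in
theorem coe_decompose_mul_ne_zero_of_uniqueAdd {x y : E} {a b : Γ}
    (ha : a ∈ (decompose 𝒜 x).support) (hb : b ∈ (decompose 𝒜 y).support)
    (h : UniqueAdd (decompose 𝒜 x).support (decompose 𝒜 y).support a b) :
    ((decompose 𝒜 (x * y)) (a + b) : E) ≠ 0 := by
  have hxa : ((decompose 𝒜 x) a : E) ≠ 0 := by simpa using ha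
  have hyb : ((decompose 𝒜 y) b : E) ≠ 0 := by simpa using hb
  have hu := hE.isUnit_of_mem ((decompose 𝒜 x) a).2 hxa
  rw [decompose_mul, coe_mul_apply, Finset.sum_eq_single (a, b)]
  · exact fun h0 => hyb (hu.mul_right_eq_zero.1 h0)
  · rintro ⟨c, d⟩ hcd hne
    simp only [Finset.mem_filter, Finset.mem_product] at hcd
    obtain ⟨h1, h2⟩ := h hcd.1.1 hcd.1.2 hcd.2
    exact absurd (Prod.ext h1 h2) hne
  · intro h'
    exact (h' (Finset.mem_filter.2 ⟨Finset.mem_product.2 ⟨ha, hb⟩, rfl⟩)).elim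

/-- If `u` had two components, two distinct pairs of degrees from `u` and `u⁻¹` would have uniquely
attained sums. Both would survive in `u * u⁻¹ = 1`, so both sums would be `0`, contradicting
uniqueness. -/
theorem exists_mem_of_unit [IsAddTorsionFree Γ] (u : Eˣ) : ∃ γ, (u : E) ∈ 𝒜 γ := by
  classical
  have := hE.nontrivial
  have := twoUniqueSums_of_torsionFree (Γ := Γ)
  obtain ⟨a, ha⟩ := decompose_support_nonempty 𝒜 u.ne_zero
  obtain ⟨b, hb⟩ := decompose_support_nonempty 𝒜 u⁻¹.ne_zero
  have hdeg : ∀ γ, ((decompose 𝒜 ((u : E) * (u⁻¹ : Eˣ))) γ : E) ≠ 0 → γ = 0 := by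
    intro γ h
    by_contra hne
    rw [Units.mul_inv] at h
    exact h (decompose_of_mem_ne 𝒜 SetLike.GradedOne.one_mem (Ne.symm hne))
  have hcard : (decompose 𝒜 (u : E)).support.card ≤ 1 := by
    by_contra! hlt
    have hlt' := lt_of_lt_of_le hlt
      (Nat.le_mul_of_pos_right _ (Finset.card_pos.2 ⟨b, hb⟩))
    obtain ⟨p, hp, q, hq, hpq, h1, h2⟩ := TwoUniqueSums.uniqueAdd_of_one_lt_card hlt'
    rw [Finset.mem_product] at hp hq
    have e1 := hdeg _ (coe_decompose_mul_ne_zero_of_uniqueAdd 𝒜 hp.1 hp.2 h1)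
    have e2 := hdeg _ (coe_decompose_mul_ne_zero_of_uniqueAdd 𝒜 hq.1 hq.2 h2)
    obtain ⟨h3, h4⟩ := h1 hq.1 hq.2 (e2.trans e1.symm)
    exact hpq (Prod.ext h3.symm h4.symm)
  refine ⟨a, ?_⟩
  have hs : (decompose 𝒜 (u : E)).support = {a} := by
    symm
    exact Finset.eq_of_subset_of_card_le (Finset.singleton_subset_iff.2 ha) (by simpa using hcard)
  rw [← sum_support_decompose 𝒜 (u : E), hs, Finset.sum_singleton]
  exact SetLike.coe_mem _

/-- The degree of a unit of a graded division ring with torsion-free grading group. -/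
def degree [IsAddTorsionFree Γ] : Eˣ →* Multiplicative Γ where
  toFun u := Multiplicative.ofAdd (exists_mem_of_unit 𝒜 u).choose
  map_one' := by
    have := hE.nontrivial
    exact congrArg Multiplicative.ofAdd (eq_of_mem_of_mem 𝒜 one_ne_zero
      (exists_mem_of_unit 𝒜 (1 : Eˣ)).choose_spec SetLike.GradedOne.one_mem)
  map_mul' u v := by
    have := hE.nontrivial
    rw [← ofAdd_add]
    exact congrArg Multiplicative.ofAdd (eq_of_mem_of_mem 𝒜 (u * v).ne_zero
      (exists_mem_of_unit 𝒜 (u * v)).choose_spec (SetLike.GradedMul.mul_mem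
        (exists_mem_of_unit 𝒜 u).choose_spec (exists_mem_of_unit 𝒜 v).choose_spec))

theorem mem_iff_degree [IsAddTorsionFree Γ] (u : Eˣ) (γ : Γ) :
    (u : E) ∈ 𝒜 γ ↔ degree 𝒜 u = Multiplicative.ofAdd γ := by
  have := hE.nontrivial
  refine ⟨fun h => congrArg Multiplicative.ofAdd (eq_of_mem_of_mem 𝒜 u.ne_zero
    (exists_mem_of_unit 𝒜 u).choose_spec h), fun h => ?_⟩
  have h' : (exists_mem_of_unit 𝒜 u).choose = γ := Multiplicative.ofAdd.injective h
  exact h' ▸ (exists_mem_of_unit 𝒜 u).choose_spec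

theorem mem_zero_iff_degree [IsAddTorsionFree Γ] (u : Eˣ) :
    (u : E) ∈ 𝒜 0 ↔ degree 𝒜 u = 1 := mem_iff_degree 𝒜 u 0

-- Nonzero homogeneous elements are units and generate `E` additively.
include 𝒜 in
theorem unit_mem_center_iff (u : Eˣ) :
    u ∈ Subgroup.center Eˣ ↔ (u : E) ∈ Subring.center E := by
  constructor
  · intro hu
    rw [Subring.mem_center_iff]
    intro g
    induction g using DirectSum.Decomposition.inductionOn 𝒜 with
    | zero => simp
    | homogeneous g =>
      by_cases hg : (g : E) = 0
      · simp [hg]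
      · obtain ⟨w, hw⟩ := hE.isUnit_of_mem g.2 hg
        rw [← hw]
        exact congrArg Units.val (Subgroup.mem_center_iff.1 hu w)
    | add x y hx hy => rw [add_mul, mul_add, hx, hy]
  · intro hu
    rw [Subgroup.mem_center_iff]
    exact fun g => Units.ext (Subring.mem_center_iff.1 hu g)

/-! ### The relative grade group as the quotient of `E^*` by its center. -/

section GradeGroup

variable [IsAddTorsionFree Γ]

/-- A subgroup of the unit group consisting of the nonzero homogeneous elements of a set `S` has
the grade group of `S` as its group of degrees. -/
theorem mem_gradeGroup_iff {S : Set E} (H : Subgroup Eˣ)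
    (hS : ∀ u : Eˣ, u ∈ H ↔ (u : E) ∈ S) (γ : Γ) :
    γ ∈ gradeGroup 𝒜 S ↔ ∃ u ∈ H, degree 𝒜 u = Multiplicative.ofAdd γ := by
  have := hE.nontrivial
  constructor
  · intro h
    refine AddSubgroup.closure_induction (p := fun γ _ =>
      ∃ u ∈ H, degree 𝒜 u = Multiplicative.ofAdd γ) ?_ ?_ ?_ ?_ h
    · rintro γ ⟨a, haS, ha, haγ⟩
      obtain ⟨u, rfl⟩ := hE.isUnit_of_mem haγ ha
      exact ⟨u, (hS u).2 haS, (mem_iff_degree 𝒜 u γ).1 haγ⟩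
    · exact ⟨1, one_mem _, by simp⟩
    · rintro x y _ _ ⟨u, hu, hx⟩ ⟨w, hw, hy⟩
      exact ⟨u * w, mul_mem hu hw, by rw [map_mul, hx, hy, ofAdd_add]⟩
    · rintro x _ ⟨u, hu, hx⟩
      exact ⟨u⁻¹, inv_mem hu, by rw [map_inv, hx, ofAdd_neg]⟩
  · rintro ⟨u, hu, h⟩
    exact AddSubgroup.subset_closure ⟨u, (hS u).1 hu, u.ne_zero, (mem_iff_degree 𝒜 u γ).2 h⟩

theorem mem_gradeGroup_univ (γ : Γ) :
    γ ∈ gradeGroup 𝒜 (Set.univ : Set E) ↔ ∃ u : Eˣ, degree 𝒜 u = Multiplicative.ofAdd γ := by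
  simpa using mem_gradeGroup_iff 𝒜 (S := Set.univ) ⊤ (by simp) γ

theorem mem_gradeGroup_center (γ : Γ) :
    γ ∈ gradeGroup 𝒜 (Subring.center E : Set E) ↔
      ∃ u ∈ Subgroup.center Eˣ, degree 𝒜 u = Multiplicative.ofAdd γ :=
  mem_gradeGroup_iff 𝒜 _ (unit_mem_center_iff 𝒜) γ

variable {𝒜} in
theorem IsTotallyRamified.mem_center_of_degree (h : IsTotallyRamified 𝒜) {u : Eˣ}
    (hu : degree 𝒜 u = 1) : u ∈ Subgroup.center Eˣ :=
  (unit_mem_center_iff 𝒜 u).2 (h u ((mem_zero_iff_degree 𝒜 u).2 hu))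

/-- The degree map onto the relative grade group. -/
def relativeDegree : Eˣ →* Multiplicative (RelativeGradeGroup 𝒜) where
  toFun u := Multiplicative.ofAdd (QuotientAddGroup.mk
    ⟨(degree 𝒜 u).toAdd, (mem_gradeGroup_univ 𝒜 _).2 ⟨u, rfl⟩⟩)
  map_one' := by
    rw [← ofAdd_zero, ← QuotientAddGroup.mk_zero]
    congr 2
    exact Subtype.ext (by simp)
  map_mul' u v := by
    rw [← ofAdd_add, ← QuotientAddGroup.mk_add]
    congr 2
    exact Subtype.ext (by simp)

theorem relativeDegree_surjective : Function.Surjective (relativeDegree 𝒜) := by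
  intro x
  obtain ⟨⟨γ, hγ⟩, h⟩ := QuotientAddGroup.mk_surjective x.toAdd
  obtain ⟨u, hu⟩ := (mem_gradeGroup_univ 𝒜 γ).1 hγ
  refine ⟨u, ?_⟩
  rw [← ofAdd_toAdd x, ← h]
  exact congrArg (fun y => Multiplicative.ofAdd (QuotientAddGroup.mk y))
    (Subtype.ext (by simp [hu]))

-- A unit with the degree of a central unit differs from it by a unit of degree zero, which is
-- central.
variable {𝒜} in
theorem IsTotallyRamified.ker_relativeDegree (h : IsTotallyRamified 𝒜) :
    (relativeDegree 𝒜).ker = Subgroup.center Eˣ := by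
  ext u
  have : relativeDegree 𝒜 u = 1 ↔ (degree 𝒜 u).toAdd ∈
      gradeGroup 𝒜 (Subring.center E : Set E) := by
    rw [← AddSubgroup.mem_addSubgroupOf (K := gradeGroup 𝒜 (Set.univ : Set E))
      (h := ⟨(degree 𝒜 u).toAdd, (mem_gradeGroup_univ 𝒜 _).2 ⟨u, rfl⟩⟩),
      ← QuotientAddGroup.eq_zero_iff]
    exact Iff.rfl
  rw [MonoidHom.mem_ker, this, mem_gradeGroup_center]
  constructor
  · rintro ⟨w, hw, h'⟩
    have h1 : u * w⁻¹ ∈ Subgroup.center Eˣ :=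
      h.mem_center_of_degree (by rw [map_mul, map_inv, h']; simp)
    simpa using mul_mem h1 hw
  · exact fun hu => ⟨u, hu, rfl⟩

variable {𝒜} in
theorem IsTotallyRamified.exponent_quotient_center (h : IsTotallyRamified 𝒜) :
    Monoid.exponent (Eˣ ⧸ Subgroup.center Eˣ) = AddMonoid.exponent (RelativeGradeGroup 𝒜) := by
  rw [← Monoid.exponent_multiplicative]
  exact Monoid.exponent_eq_of_mulEquiv
    ((QuotientGroup.quotientMulEquivOfEq h.ker_relativeDegree.symm).trans
      (QuotientGroup.quotientKerEquivOfSurjective _ (relativeDegree_surjective 𝒜)))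

variable {𝒜} in
open scoped commutatorElement in
theorem IsTotallyRamified.commutatorElement_mem_center (h : IsTotallyRamified 𝒜) (u w : Eˣ) :
    ⁅u, w⁆ ∈ Subgroup.center Eˣ :=
  h.mem_center_of_degree (by
    rw [map_commutatorElement]
    exact commutatorElement_eq_one_iff_commute.2 (Commute.all _ _))

end GradeGroup

end GradedUnits

/-! ### The commutator pairing of a group whose commutators lie in a central copy of `F^*`. -/

section CommutatorPairing

open scoped commutatorElement

variable {U : Type*} [Group U] {F : Type*} [Field F] {ι : Fˣ →* U}

theorem commutatorElement_mul_left_of_mem_center {a b c : U} (h : ⁅b, c⁆ ∈ Subgroup.center U) :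
    ⁅a * b, c⁆ = ⁅a, c⁆ * ⁅b, c⁆ := by
  have h1 : a * ⁅b, c⁆ = ⁅b, c⁆ * a := Subgroup.mem_center_iff.1 h a
  have h2 : ⁅a, c⁆ * ⁅b, c⁆ = ⁅b, c⁆ * ⁅a, c⁆ := Subgroup.mem_center_iff.1 h _
  calc ⁅a * b, c⁆ = (a * ⁅b, c⁆) * c * a⁻¹ * c⁻¹ := by simp only [commutatorElement_def]; group
    _ = ⁅b, c⁆ * ⁅a, c⁆ := by rw [h1]; simp only [commutatorElement_def]; group
    _ = _ := h2.symm

theorem commutatorElement_mul_right_of_mem_center {a b c : U} (h : ⁅a, c⁆ ∈ Subgroup.center U) :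
    ⁅a, b * c⁆ = ⁅a, b⁆ * ⁅a, c⁆ := by
  have h1 : b * ⁅a, c⁆ = ⁅a, c⁆ * b := Subgroup.mem_center_iff.1 h b
  have h2 : ⁅a, b⁆ * ⁅a, c⁆ = ⁅a, c⁆ * ⁅a, b⁆ := Subgroup.mem_center_iff.1 h _
  calc ⁅a, b * c⁆ = a * b * a⁻¹ * ⁅a, c⁆ * b⁻¹ := by simp only [commutatorElement_def]; group
    _ = a * b * a⁻¹ * (b⁻¹ * (b * ⁅a, c⁆)) * b⁻¹ := by group
    _ = ⁅a, b⁆ * ⁅a, c⁆ := by rw [h1]; simp only [commutatorElement_def, mul_assoc]; group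
    _ = _ := rfl

/-- If all commutators of a group lie in a central copy of the unit group of a field, they are
the values of a pairing with values in that unit group. -/
theorem exists_commutator_pairing (hι : Function.Injective ι) (hc : ι.range ≤ Subgroup.center U)
    (hcomm : ∀ u v : U, ⁅u, v⁆ ∈ ι.range) :
    ∃ β : U →* U →* Fˣ, ∀ u v, ι (β u v) = ⁅u, v⁆ := by
  choose f hf using hcomm
  exact ⟨MonoidHom.mk' (fun u => MonoidHom.mk' (f u) fun v w => hι (by
      rw [map_mul, hf, hf, hf, commutatorElement_mul_right_of_mem_center (hc ⟨_, hf u w⟩)]))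
    fun u w => MonoidHom.ext fun v => hι (by
      simp [hf, commutatorElement_mul_left_of_mem_center (hc ⟨_, hf w v⟩)]), fun u v => hf u v⟩

variable {β : U →* U →* Fˣ} (hι : Function.Injective ι) (hβ : ∀ u v, ι (β u v) = ⁅u, v⁆)

include hι hβ

theorem pairing_eq_one_iff (u v : U) : β u v = 1 ↔ Commute u v := by
  rw [← commutatorElement_eq_one_iff_commute, ← hβ, ← map_one ι, hι.eq_iff]

theorem pairing_self (u : U) : β u u = 1 := (pairing_eq_one_iff hι hβ u u).2 (Commute.refl u)

theorem pairing_swap (u v : U) : β v u = (β u v)⁻¹ := by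
  apply hι
  rw [map_inv, hβ, hβ, commutatorElement_inv]

theorem pairing_ker : β.ker = Subgroup.center U := by
  ext u
  rw [MonoidHom.mem_ker, Subgroup.mem_center_iff]
  constructor
  · intro h v
    exact ((pairing_eq_one_iff hι hβ u v).1 (by rw [h]; rfl)).eq.symm
  · intro h
    ext v
    exact congrArg Units.val ((pairing_eq_one_iff hι hβ u v).2 (h v).symm)

theorem pairing_pow_exponent (u v : U) :
    β u v ^ Monoid.exponent (U ⧸ Subgroup.center U) = 1 := by
  have h : u ^ Monoid.exponent (U ⧸ Subgroup.center U) ∈ β.ker := by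
    rw [pairing_ker hι hβ, ← QuotientGroup.eq_one_iff, QuotientGroup.mk_pow,
      Monoid.pow_exponent_eq_one]
  rw [← MonoidHom.pow_apply, ← map_pow, MonoidHom.mem_ker.1 h, MonoidHom.one_apply]

variable [Finite (U ⧸ Subgroup.center U)]

/-- The image of `β` is a finite abelian group isomorphic to `U/Z(U)`, so some `β u` has order equal
to the exponent. The values of `β u` form a finite group of roots of unity in a field, hence a
cyclic one; the order of a generator `β u v` kills every `β u w`, so it is the order of `β u`. -/
theorem exists_pairing_isPrimitiveRoot :
    ∃ u v, IsPrimitiveRoot (β u v) (Monoid.exponent (U ⧸ Subgroup.center U)) := by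
  set e := Monoid.exponent (U ⧸ Subgroup.center U) with he
  have he0 : e ≠ 0 := Monoid.exponent_ne_zero_of_finite
  have : NeZero e := ⟨he0⟩
  have hexp : Monoid.exponent β.range = e := by
    rw [he, ← Monoid.exponent_eq_of_mulEquiv (QuotientGroup.quotientKerEquivRange β)]
    exact Monoid.exponent_eq_of_mulEquiv
      (QuotientGroup.quotientMulEquivOfEq (pairing_ker hι hβ))
  obtain ⟨⟨_, u, rfl⟩, hu⟩ := Monoid.exists_orderOf_eq_exponent
    (Monoid.exponent_ne_zero.1 (hexp.trans_ne he0))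
  rw [hexp, ← orderOf_injective β.range.subtype Subtype.val_injective] at hu
  have hu : orderOf (β u) = e := hu
  have hle : (β u).range ≤ rootsOfUnity e F := by
    rintro _ ⟨v, rfl⟩
    exact (mem_rootsOfUnity e _).2 (pairing_pow_exponent hι hβ u v)
  have hfin : Finite (β u).range := Finite.of_injective _ (Subgroup.inclusion_injective hle)
  obtain ⟨⟨_, v, rfl⟩, hv⟩ := IsCyclic.exists_generator (α := (β u).range)
  refine ⟨u, v, ?_⟩
  rw [IsPrimitiveRoot.iff_orderOf]
  refine Nat.dvd_antisymm (orderOf_dvd_of_pow_eq_one (pairing_pow_exponent hι hβ u v)) ?_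
  rw [← hu]
  refine orderOf_dvd_of_pow_eq_one (MonoidHom.ext fun w => ?_)
  obtain ⟨k, hk⟩ := Subgroup.mem_zpowers_iff.1 (hv ⟨β u w, w, rfl⟩)
  have hk : β u v ^ k = β u w := congrArg Subtype.val hk
  rw [MonoidHom.pow_apply, ← hk, ← zpow_natCast, ← zpow_mul, mul_comm, zpow_mul, zpow_natCast,
    pow_orderOf_eq_one, one_zpow, MonoidHom.one_apply]

theorem exists_pairing_eq_of_mem_rootsOfUnity {ω : Fˣ}
    (hω : ω ∈ rootsOfUnity (Monoid.exponent (U ⧸ Subgroup.center U)) F) :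
    ∃ u v, β u v = ω := by
  have : NeZero (Monoid.exponent (U ⧸ Subgroup.center U)) :=
    ⟨Monoid.exponent_ne_zero_of_finite⟩
  obtain ⟨u, v, h⟩ := exists_pairing_isPrimitiveRoot hι hβ
  rw [← h.zpowers_eq, Subgroup.mem_zpowers_iff] at hω
  obtain ⟨k, hk⟩ := hω
  exact ⟨u ^ k, v, by rw [map_zpow, MonoidHom.zpow_apply, hk]⟩

theorem commutator_eq_map_rootsOfUnity :
    commutator U = (rootsOfUnity (Monoid.exponent (U ⧸ Subgroup.center U)) F).map ι := by
  apply le_antisymm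
  · rw [commutator_def, Subgroup.commutator_le]
    rintro u - v -
    exact ⟨β u v, (mem_rootsOfUnity _ _).2 (pairing_pow_exponent hι hβ u v), hβ u v⟩
  · rintro _ ⟨ω, hω, rfl⟩
    obtain ⟨u, v, rfl⟩ := exists_pairing_eq_of_mem_rootsOfUnity hι hβ hω
    rw [hβ]
    exact Subgroup.commutator_mem_commutator (Subgroup.mem_top u) (Subgroup.mem_top v)

/-- With `β u v` primitive, `w ↦ (β u w, β v w)` maps `U/Z(U)` onto `μ_e × μ_e`, whence `e² ∣ n²`.
-/
theorem exponent_dvd_of_card_eq_sq {n : ℕ} (hn : Nat.card (U ⧸ Subgroup.center U) = n ^ 2) :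
    Monoid.exponent (U ⧸ Subgroup.center U) ∣ n := by
  set e := Monoid.exponent (U ⧸ Subgroup.center U) with he
  have : NeZero e := ⟨Monoid.exponent_ne_zero_of_finite⟩
  obtain ⟨u, v, h⟩ := exists_pairing_isPrimitiveRoot hι hβ
  let φ : U →* Fˣ × Fˣ := (β u).prod (β v)
  have hrange : φ.range = (rootsOfUnity e F).prod (rootsOfUnity e F) := by
    apply le_antisymm
    · rintro _ ⟨w, rfl⟩
      exact ⟨(mem_rootsOfUnity _ _).2 (pairing_pow_exponent hι hβ u w),
        (mem_rootsOfUnity _ _).2 (pairing_pow_exponent hι hβ v w)⟩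
    · rintro ⟨a, b⟩ ⟨ha, hb⟩
      rw [← h.zpowers_eq] at ha hb
      obtain ⟨i, rfl : _ = a⟩ := Subgroup.mem_zpowers_iff.1 ha
      obtain ⟨j, rfl : _ = b⟩ := Subgroup.mem_zpowers_iff.1 hb
      -- The negative exponent compensates `β v u = (β u v)⁻¹`; the diagonal values of `β` are
      -- trivial.
      refine ⟨v ^ i * u ^ (-j), ?_⟩
      simp [φ, pairing_self hι hβ, pairing_swap hι hβ u v]
  have hker : Subgroup.center U ≤ φ.ker := by
    intro w hw
    rw [← pairing_ker hι hβ] at hw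
    have key : ∀ x, β x w = 1 := fun x => by
      rw [pairing_swap hι hβ w x, MonoidHom.mem_ker.1 hw, MonoidHom.one_apply, inv_one]
    exact Prod.ext (key u) (key v)
  have hdvd := Subgroup.index_dvd_of_le hker
  rw [Subgroup.index_ker, hrange, Nat.card_congr (Subgroup.prodEquiv _ _).toEquiv, Nat.card_prod,
    Subgroup.index_eq_card, hn, h.card_rootsOfUnity', ← sq] at hdvd
  exact (Nat.pow_dvd_pow_iff two_ne_zero).1 hdvd

end CommutatorPairing

theorem prime_dvd_exponent_of_dvd_card {G : Type*} [Group G] [Finite G] {p : ℕ} (hp : p.Prime)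
    (h : p ∣ Nat.card G) : p ∣ Monoid.exponent G := by
  have : Fact p.Prime := ⟨hp⟩
  obtain ⟨g, hg⟩ := exists_prime_orderOf_dvd_card' p h
  exact hg ▸ Monoid.order_dvd_exponent g

/-! ### Simplicity of twisted algebras, and reduced norms of scalars. -/

/-- Shortest-element argument. If `g` and `h` both occur in `x ∈ I`, choose `u` whose conjugation
scales `b g` and `b h` differently: `u x u⁻¹ - c g • x` loses `g`, keeps `h`, gains nothing new, and
stays in `I`. The descent ends at a nonzero multiple of a single `b g`, a unit. -/
theorem isSimpleRing_of_basis {F B G : Type*} [Field F] [Ring B] [Algebra F B] [Nonempty G]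
    (b : Module.Basis G F B) (hb : ∀ g, IsUnit (b g))
    (hconj : ∀ g h, g ≠ h → ∃ (u : Bˣ) (c : G → F),
      (∀ i, (u : B) * b i * (u⁻¹ : Bˣ) = c i • b i) ∧ c g ≠ c h) : IsSimpleRing B := by
  classical
  have : Nontrivial B := ⟨⟨b (Classical.arbitrary G), 0, b.ne_zero _⟩⟩
  have key : ∀ (I : TwoSidedIdeal B) (n : ℕ) (x : B), x ∈ I → x ≠ 0 →
      (b.repr x).support.card = n → (1 : B) ∈ I := by
    intro I n
    induction n using Nat.strong_induction_on with
    | _ n ih =>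
      intro x hx hx0 hn
      have hne : (b.repr x).support.Nonempty := by
        rw [Finset.nonempty_iff_ne_empty, Ne, Finsupp.support_eq_empty]
        simpa using hx0
      obtain ⟨g, hg⟩ := hne
      by_cases hone : ∃ h ∈ (b.repr x).support, h ≠ g
      · obtain ⟨h, hh, hhg⟩ := hone
        obtain ⟨u, c, hc, hcgh⟩ := hconj g h hhg.symm
        have hrepr : ∀ (y : B) (i : G),
            b.repr ((u : B) * y * (u⁻¹ : Bˣ)) i = c i * b.repr y i := by
          intro y i
          have hL : b.coord i ∘ₗ LinearMap.mulRight F ((u⁻¹ : Bˣ) : B) ∘ₗ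
              LinearMap.mulLeft F (u : B) = c i • b.coord i := by
            refine b.ext fun k => ?_
            simp only [LinearMap.comp_apply, LinearMap.mulLeft_apply, LinearMap.mulRight_apply,
              hc, map_smul, LinearMap.smul_apply, Module.Basis.coord_apply, Module.Basis.repr_self]
            by_cases hki : k = i
            · simp [hki]
            · simp [hki]
          exact LinearMap.congr_fun hL y
        let y := (u : B) * x * (u⁻¹ : Bˣ) - c g • x
        have hy : ∀ i, b.repr y i = (c i - c g) * b.repr x i := by
          intro i
          simp [y, hrepr, sub_mul]
        have hyI : y ∈ I := by
          refine I.sub_mem (I.mul_mem_right _ _ (I.mul_mem_left _ _ hx)) ?_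
          rw [Algebra.smul_def]
          exact I.mul_mem_left _ _ hx
        have hhy : h ∈ (b.repr y).support := by
          rw [Finsupp.mem_support_iff, hy]
          exact mul_ne_zero (sub_ne_zero.2 hcgh.symm) (Finsupp.mem_support_iff.1 hh)
        have hy0 : y ≠ 0 := by
          intro h0
          simp [h0] at hhy
        have hsub : (b.repr y).support ⊆ (b.repr x).support.erase g := by
          intro i hi
          rw [Finsupp.mem_support_iff, hy] at hi
          rw [Finset.mem_erase, Finsupp.mem_support_iff]
          refine ⟨?_, right_ne_zero_of_mul hi⟩
          rintro rfl
          simp at hi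
        exact ih _ (hn ▸ (Finset.card_le_card hsub).trans_lt (Finset.card_erase_lt_of_mem hg))
          y hyI hy0 rfl
      · push Not at hone
        have hxg : x = b.repr x g • b g := by
          apply b.repr.injective
          ext i
          by_cases hig : i = g
          · simp [hig]
          · have : b.repr x i = 0 := by
              by_contra h0
              exact hig (hone i (Finsupp.mem_support_iff.2 h0))
            simp [this, Ne.symm hig]
        have hu : IsUnit x := by
          rw [hxg, Algebra.smul_def]
          exact ((IsUnit.mk0 _ (Finsupp.mem_support_iff.1 hg)).map (algebraMap F B)).mul (hb g)
        obtain ⟨w, hw⟩ := hu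
        rw [← w.inv_mul, hw]
        exact I.mul_mem_left _ _ hx
  refine ⟨⟨fun I => ?_⟩⟩
  by_cases h : I = ⊥
  · exact Or.inl h
  · right
    obtain ⟨x, hx, hx0⟩ : ∃ x ∈ I, x ≠ 0 := by
      by_contra! hall
      refine h (le_antisymm (fun x hx => ?_) bot_le)
      rw [hall x hx]
      exact TwoSidedIdeal.zero_mem _
    refine le_antisymm le_top fun y _ => ?_
    rw [← mul_one y]
    exact I.mul_mem_left _ _ (key I _ x hx hx0 rfl)

theorem one_tmul_smul_eq_algebraMap_smul {R S M : Type*} [CommRing R] [CommRing S] [Algebra R S]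
    [AddCommGroup M] [Module R M] (r : R) (x : M) :
    (1 : S) ⊗ₜ[R] (r • x) = algebraMap R S r • ((1 : S) ⊗ₜ[R] x) := by
  rw [TensorProduct.smul_tmul', ← TensorProduct.smul_tmul, Algebra.algebraMap_eq_smul_one,
    smul_eq_mul, mul_one]

/-- The splitting sends a scalar to a scalar matrix, whose size is `n` by dimension; thus the choice
of splitting does not matter here. -/
theorem reducedNorm_algebraMap {K : Type u} [Field K] {A : Type v} [Ring A] [Algebra K A]
    (h : HasSplitting K A) {n : ℕ} (hn : Module.finrank K A = n ^ 2) (a : K) :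
    reducedNorm K A (algebraMap K A a) = algebraMap K (AlgebraicClosure K) a ^ n := by
  have hm : h.choose = n := by
    have h1 := h.choose_spec.some.toLinearEquiv.finrank_eq
    rw [Module.finrank_baseChange, hn, Module.finrank_matrix] at h1
    simp only [Fintype.card_fin, Module.finrank_self, mul_one, ← sq] at h1
    exact (Nat.pow_left_injective two_ne_zero h1).symm
  rw [reducedNorm, dif_pos h]
  change Matrix.det (h.choose_spec.some ((1 : AlgebraicClosure K) ⊗ₜ[K] algebraMap K A a)) = _
  have h2 : (1 : AlgebraicClosure K) ⊗ₜ[K] algebraMap K A a =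
      algebraMap (AlgebraicClosure K) (AlgebraicClosure K ⊗[K] A)
        (algebraMap K (AlgebraicClosure K) a) := by
    rw [Algebra.algebraMap_eq_smul_one (R := K) (A := A), one_tmul_smul_eq_algebraMap_smul,
      ← Algebra.TensorProduct.one_def, ← Algebra.algebraMap_eq_smul_one]
  rw [h2, AlgEquiv.commutes, Matrix.algebraMap_eq_diagonal, Matrix.det_diagonal]
  simp [hm]

/-! ### A basis of `E` over its center, and the units of reduced norm one. -/

section CenterBasis

open DirectSum
open scoped commutatorElement

variable {Γ : Type v} [AddCommGroup Γ] [DecidableEq Γ] {E : Type u} [Ring E]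
  {𝒜 : Γ → AddSubgroup E} [GradedRing 𝒜] [hE : IsGradedDivisionRing 𝒜]

variable (𝒜) in
include 𝒜 in
theorem span_out : ⊤ ≤ Submodule.span (Subring.center E)
    (Set.range fun g : Eˣ ⧸ Subgroup.center Eˣ => ((g.out : Eˣ) : E)) := by
  rintro a -
  induction a using DirectSum.Decomposition.inductionOn 𝒜 with
  | zero => exact zero_mem _
  | add x y hx hy => exact add_mem hx hy
  | homogeneous a =>
    by_cases ha : (a : E) = 0
    · rw [ha]; exact zero_mem _
    obtain ⟨w, hw⟩ := hE.isUnit_of_mem a.2 ha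
    have hc : (QuotientGroup.mk w : Eˣ ⧸ Subgroup.center Eˣ).out⁻¹ * w ∈ Subgroup.center Eˣ :=
      QuotientGroup.eq.1 (QuotientGroup.out_eq' _)
    have hc' := (unit_mem_center_iff 𝒜 _).1 hc
    rw [← hw]
    have : (w : E) = (⟨_, hc'⟩ : Subring.center E) •
        (((QuotientGroup.mk w : Eˣ ⧸ Subgroup.center Eˣ).out : Eˣ) : E) := by
      rw [Subring.smul_def, smul_eq_mul, ← Subring.mem_center_iff.1 hc', ← Units.val_mul,
        mul_inv_cancel_left]
    rw [this]
    exact Submodule.smul_mem _ _ (Submodule.subset_span ⟨_, rfl⟩)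

variable [IsAddTorsionFree Γ]

namespace IsTotallyRamified

variable (h : IsTotallyRamified 𝒜)

include h

/-- In a vanishing combination, fix a nonzero component of degree `δ` of the coefficient of `g` and
take the component of degree `δ + γ g` of the sum. If another `i` contributed, `γ g - γ i` would be
a difference of degrees of central units, so `i` and `g` would be the same coset. A single nonzero
term remains. -/
theorem linearIndependent_out : LinearIndependent (Subring.center E)
    (fun g : Eˣ ⧸ Subgroup.center Eˣ => ((g.out : Eˣ) : E)) := by
  classical
  rw [linearIndependent_iff']
  intro s f hf g hg
  by_contra hfg
  have hfg' : (f g : E) ≠ 0 := fun h0 => hfg (Subtype.ext h0)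
  obtain ⟨δ, hδ⟩ := decompose_support_nonempty 𝒜 hfg'
  have hδ' : ((decompose 𝒜 (f g : E)) δ : E) ≠ 0 := by simpa using hδ
  let γ : (Eˣ ⧸ Subgroup.center Eˣ) → Γ := fun i => (degree 𝒜 i.out).toAdd
  have hγ : ∀ i, ((i.out : Eˣ) : E) ∈ 𝒜 (γ i) := fun i => (mem_iff_degree 𝒜 _ _).2 rfl
  have hcomp : ∀ i, ((decompose 𝒜 (f i • ((i.out : Eˣ) : E))) (δ + γ g) : E) =
      (decompose 𝒜 (f i : E)) (δ + γ g - γ i) * ((i.out : Eˣ) : E) := by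
    intro i
    rw [← coe_decompose_mul_add_of_right_mem 𝒜 (hγ i), sub_add_cancel]
    rfl
  have hzero : ∀ i ∈ s, i ≠ g →
      ((decompose 𝒜 (f i • ((i.out : Eˣ) : E))) (δ + γ g) : E) = 0 := by
    intro i _ hi
    rw [hcomp]
    by_contra h0
    have h1 := left_ne_zero_of_mul h0
    obtain ⟨w, hw⟩ := hE.isUnit_of_mem (SetLike.coe_mem _) hδ'
    obtain ⟨w', hw'⟩ := hE.isUnit_of_mem (SetLike.coe_mem _) h1
    have hwc : w ∈ Subgroup.center Eˣ := by
      rw [unit_mem_center_iff 𝒜, hw]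
      exact decompose_mem_center 𝒜 (f g).2 _
    have hwc' : w' ∈ Subgroup.center Eˣ := by
      rw [unit_mem_center_iff 𝒜, hw']
      exact decompose_mem_center 𝒜 (f i).2 _
    have hdw : degree 𝒜 w = Multiplicative.ofAdd δ :=
      (mem_iff_degree 𝒜 _ _).1 (hw ▸ SetLike.coe_mem _)
    have hdw' : degree 𝒜 w' = Multiplicative.ofAdd (δ + γ g - γ i) :=
      (mem_iff_degree 𝒜 _ _).1 (hw' ▸ SetLike.coe_mem _)
    have hc : w'⁻¹ * w * (i.out⁻¹ * g.out) ∈ Subgroup.center Eˣ := by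
      apply h.mem_center_of_degree
      rw [map_mul, map_mul, map_mul, map_inv, map_inv, hdw, hdw']
      apply Multiplicative.toAdd.injective
      simp only [toAdd_mul, toAdd_inv, toAdd_ofAdd, toAdd_one, γ]
      abel
    have hc' : i.out⁻¹ * g.out ∈ Subgroup.center Eˣ :=
      (Subgroup.mul_mem_cancel_left _ (mul_mem (inv_mem hwc') hwc)).1 hc
    apply hi
    rw [← QuotientGroup.out_eq' i, ← QuotientGroup.out_eq' g]
    exact QuotientGroup.eq.2 hc'
  have h0 : ((decompose 𝒜 (∑ i ∈ s, f i • ((i.out : Eˣ) : E))) (δ + γ g) : E) = 0 := by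
    rw [hf]; simp
  rw [decompose_sum, DFinsupp.finsetSum_apply, AddSubgroup.val_finsetSum,
    Finset.sum_eq_single g hzero (fun hh => absurd hg hh), hcomp, add_sub_cancel_right] at h0
  exact hδ' ((Units.mul_left_eq_zero _).1 h0)

/-- Representatives of the units modulo the central units form a basis over the center. -/
def centerBasis : Module.Basis (Eˣ ⧸ Subgroup.center Eˣ) (Subring.center E) E :=
  Module.Basis.mk h.linearIndependent_out (span_out 𝒜)

theorem centerBasis_apply (g : Eˣ ⧸ Subgroup.center Eˣ) :
    h.centerBasis g = ((g.out : Eˣ) : E) := by simp [centerBasis]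

theorem finite_quotient_center [Module.Finite (Subring.center E) E] :
    Finite (Eˣ ⧸ Subgroup.center Eˣ) :=
  have := hE.nontrivial
  Module.Finite.finite_basis h.centerBasis

theorem card_quotient_center :
    Nat.card (Eˣ ⧸ Subgroup.center Eˣ) = Module.finrank (Subring.center E) E :=
  have := hE.nontrivial
  (Module.finrank_eq_nat_card_basis h.centerBasis).symm

/-- After extension to the algebraic closure, coset representatives are a basis of units on which
conjugation acts by commutators. The algebra is therefore simple, and a finite-dimensional simple
algebra over an algebraically closed field is a matrix algebra. -/
theorem hasSplitting [Module.Finite (Subring.center E) E] :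
    HasSplitting (CenterQuotientField 𝒜) (QuotientDivisionRing 𝒜) := by
  have := hE.nontrivial
  let K := CenterQuotientField 𝒜
  let F := AlgebraicClosure K
  let B := F ⊗[K] QuotientDivisionRing 𝒜
  let b : Module.Basis (Eˣ ⧸ Subgroup.center Eˣ) F B := (h.centerBasis.baseChange K).baseChange F
  let j : E →* B :=
    ((Algebra.TensorProduct.includeRight : QuotientDivisionRing 𝒜 →ₐ[K] B) :
      QuotientDivisionRing 𝒜 →* B).comp
    ((Algebra.TensorProduct.includeRight : E →ₐ[Subring.center E] QuotientDivisionRing 𝒜) :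
      E →* QuotientDivisionRing 𝒜)
  have hbj : ∀ g, b g = j ((g.out : Eˣ) : E) := by
    intro g
    refine (Module.Basis.baseChange_apply F _ g).trans ?_
    refine (congrArg (fun x => (1 : F) ⊗ₜ[K] x)
      (Module.Basis.baseChange_apply K h.centerBasis g)).trans ?_
    rw [h.centerBasis_apply]
    rfl
  have hsmul : ∀ (t : Subring.center E) (x : E),
      j ((t : E) * x) = algebraMap K F (algebraMap (Subring.center E) K t) • j x := by
    intro t x
    change (1 : F) ⊗ₜ[K] ((1 : K) ⊗ₜ[Subring.center E] (t • x)) = _ • ((1 : F) ⊗ₜ[K] (1 ⊗ₜ x))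
    rw [one_tmul_smul_eq_algebraMap_smul, one_tmul_smul_eq_algebraMap_smul]
  have hinj : Function.Injective
      fun t : Subring.center E => algebraMap K F (algebraMap (Subring.center E) K t) :=
    (algebraMap K F).injective.comp (IsFractionRing.injective (Subring.center E) K)
  have : IsSimpleRing B := by
    refine isSimpleRing_of_basis b (fun g => hbj g ▸ (Units.isUnit _).map j) fun g g' hgg' => ?_
    -- Distinct cosets have distinct commutator characters: otherwise `g.out⁻¹ * g'.out` would
    -- commute with every unit.
    have hex : ∃ u : Eˣ, ⁅u, g.out⁆ ≠ ⁅u, g'.out⁆ := by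
      by_contra! hall
      apply hgg'
      rw [← QuotientGroup.out_eq' g, ← QuotientGroup.out_eq' g']
      refine QuotientGroup.eq.2 (Subgroup.mem_center_iff.2 fun u => ?_)
      have h1 : ⁅u, g.out * (g.out⁻¹ * g'.out)⁆ = ⁅u, g.out⁆ * ⁅u, g.out⁻¹ * g'.out⁆ :=
        commutatorElement_mul_right_of_mem_center (h.commutatorElement_mem_center _ _)
      rw [mul_inv_cancel_left, hall u, left_eq_mul] at h1
      exact (commutatorElement_eq_one_iff_commute.1 h1).eq
    obtain ⟨u, hu⟩ := hex
    let c : (Eˣ ⧸ Subgroup.center Eˣ) → Subring.center E := fun i =>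
      ⟨(⁅u, i.out⁆ : Eˣ), (unit_mem_center_iff 𝒜 _).1 (h.commutatorElement_mem_center u i.out)⟩
    refine ⟨Units.map j u, fun i => algebraMap K F (algebraMap (Subring.center E) K (c i)),
      fun i => ?_, fun hc => hu (Units.ext (congrArg Subtype.val (hinj hc)))⟩
    rw [hbj, ← hsmul, ← map_inv, Units.coe_map, Units.coe_map, ← map_mul, ← map_mul,
      ← Units.val_mul, ← Units.val_mul, ← Units.val_mul, commutatorElement_def]
    simp
  have : FiniteDimensional F B := inferInstance
  obtain ⟨m, _, hm⟩ := IsSimpleRing.exists_algEquiv_matrix_of_isAlgClosed F B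
  exact ⟨m, hm⟩

theorem nrd_of_mem_center [Module.Finite (Subring.center E) E] {n : ℕ}
    (hn : Module.finrank (Subring.center E) E = n ^ 2) (t : Subring.center E) :
    nrd 𝒜 (t : E) = algebraMap (CenterQuotientField 𝒜) _
      (algebraMap (Subring.center E) (CenterQuotientField 𝒜) t) ^ n := by
  have := hE.nontrivial
  have := Module.Free.of_basis h.centerBasis
  have hn' : Module.finrank (CenterQuotientField 𝒜) (QuotientDivisionRing 𝒜) = n ^ 2 := by
    rw [Module.finrank_baseChange, hn]
  rw [← reducedNorm_algebraMap h.hasSplitting hn']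
  change reducedNorm _ _ ((1 : CenterQuotientField 𝒜) ⊗ₜ[Subring.center E] (t : E)) = _
  congr 1
  rw [← mul_one (t : E), ← smul_eq_mul, ← Subring.smul_def, one_tmul_smul_eq_algebraMap_smul,
    ← Algebra.TensorProduct.one_def, ← Algebra.algebraMap_eq_smul_one]

theorem nrd_eq_one_iff_of_mem_center [Module.Finite (Subring.center E) E] {n : ℕ}
    (hn : Module.finrank (Subring.center E) E = n ^ 2) {a : E} (ha : a ∈ Subring.center E) :
    nrd 𝒜 a = 1 ↔ a ^ n = 1 := by
  have h1 := h.nrd_of_mem_center hn ⟨a, ha⟩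
  rw [h1, ← map_pow, ← map_pow, ← map_one (algebraMap (CenterQuotientField 𝒜) _),
    (algebraMap (CenterQuotientField 𝒜) _).injective.eq_iff,
    ← map_one (algebraMap (Subring.center E) (CenterQuotientField 𝒜)),
    (IsFractionRing.injective (Subring.center E) (CenterQuotientField 𝒜)).eq_iff, Subtype.ext_iff]
  rfl

theorem nrd_eq_one_iff [Module.Finite (Subring.center E) E] {n : ℕ}
    (hn : Module.finrank (Subring.center E) E = n ^ 2) (u : Eˣ) :
    nrd 𝒜 (u : E) = 1 ↔ degree 𝒜 u = 1 ∧ u ^ n = 1 := by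
  have := hE.nontrivial
  have := h.finite_quotient_center
  have hn0 : n ≠ 0 := by
    rintro rfl
    rw [← h.card_quotient_center] at hn
    exact Nat.card_pos.ne' (hn.trans (by simp))
  constructor
  · intro hu
    -- `u ^ e` is central of norm one, so `u ^ (e * n) = 1`, and the degree of `u` vanishes because
    -- `Γ` is torsion-free.
    have hdeg : degree 𝒜 u = 1 := by
      set e := Monoid.exponent (Eˣ ⧸ Subgroup.center Eˣ)
      have he : e ≠ 0 := Monoid.exponent_ne_zero_of_finite
      have hc : u ^ e ∈ Subgroup.center Eˣ := by
        rw [← QuotientGroup.eq_one_iff, QuotientGroup.mk_pow, Monoid.pow_exponent_eq_one]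
      have h1 : nrd 𝒜 ((u ^ e : Eˣ) : E) = 1 := by
        rw [Units.val_pow_eq_pow_val, map_pow, hu, one_pow]
      rw [h.nrd_eq_one_iff_of_mem_center hn ((unit_mem_center_iff 𝒜 _).1 hc),
        ← Units.val_pow_eq_pow_val, Units.val_eq_one, ← pow_mul] at h1
      have h2 := congrArg (degree 𝒜) h1
      rw [map_pow, map_one] at h2
      exact (pow_eq_one_iff_left (mul_ne_zero he hn0)).1 h2
    refine ⟨hdeg, ?_⟩
    have hc := (unit_mem_center_iff 𝒜 _).1 (h.mem_center_of_degree hdeg)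
    rw [h.nrd_eq_one_iff_of_mem_center hn hc] at hu
    exact Units.ext (by simpa using hu)
  · rintro ⟨hdeg, hu⟩
    have hc := (unit_mem_center_iff 𝒜 _).1 (h.mem_center_of_degree hdeg)
    rw [h.nrd_eq_one_iff_of_mem_center hn hc, ← Units.val_pow_eq_pow_val, hu, Units.val_one]

end IsTotallyRamified

end CenterBasis

open scoped commutatorElement

/-- Surjectivity is only required modulo `K'`, and `K` need not lie in `H`: this suits the
decomposition of a unit as `t * s`, where `f` reaches only `t`. -/
theorem nonempty_quotient_mulEquiv {A B : Type*} [Group A] [Group B] (f : A →* B)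
    {H K : Subgroup A} {H' K' : Subgroup B} [(K.subgroupOf H).Normal] [(K'.subgroupOf H').Normal]
    (hH : ∀ a ∈ H, f a ∈ H') (hK : ∀ a ∈ H, f a ∈ K' ↔ a ∈ K)
    (hs : ∀ b ∈ H', ∃ a ∈ H, (f a)⁻¹ * b ∈ K') :
    Nonempty (H ⧸ K.subgroupOf H ≃* H' ⧸ K'.subgroupOf H') := by
  let g : H →* H' ⧸ K'.subgroupOf H' :=
    (QuotientGroup.mk' _).comp ((f.comp H.subtype).codRestrict H' fun a => hH a a.2)
  have hg : Function.Surjective g := by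
    intro x
    obtain ⟨b, rfl⟩ := QuotientGroup.mk_surjective x
    obtain ⟨a, ha, hab⟩ := hs b b.2
    exact ⟨⟨a, ha⟩, QuotientGroup.eq.2 (Subgroup.mem_subgroupOf.2 hab)⟩
  have hker : g.ker = K.subgroupOf H := by
    ext a
    rw [Subgroup.mem_subgroupOf, ← hK a a.2]
    exact (QuotientGroup.eq_one_iff _).trans Subgroup.mem_subgroupOf
  exact ⟨(QuotientGroup.quotientMulEquivOfEq hker.symm).trans
    (QuotientGroup.quotientKerEquivOfSurjective g hg)⟩

/-! ### Hilbert 90 for a field with involution. -/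

section InvolutiveField

variable {F : Type*} [Field F] [StarRing F]

variable (F) in
/-- The homomorphism `t ↦ t τ(t)⁻¹` on the unit group of a field with an involution `τ`. -/
def divStar : Fˣ →* Fˣ where
  toFun t := t * (star t)⁻¹
  map_one' := by simp
  map_mul' s t := by rw [star_mul', mul_inv, mul_mul_mul_comm]

theorem divStar_apply (t : Fˣ) : divStar F t = t * (star t)⁻¹ := rfl

theorem divStar_eq_one_iff (t : Fˣ) : divStar F t = 1 ↔ star t = t := by
  rw [divStar_apply, mul_inv_eq_one, eq_comm]

theorem star_divStar (t : Fˣ) : star (divStar F t) = (divStar F t)⁻¹ := by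
  rw [divStar_apply, star_mul', star_inv, star_star, mul_inv, inv_inv, mul_comm]

/-- Hilbert's Theorem 90 for a nontrivial involution of a field. -/
theorem exists_divStar_eq {d : F} (hd : star d ≠ d) {c : Fˣ} (hc : star c = c⁻¹) :
    ∃ x, divStar F x = c := by
  have hc' : (c : F) * star (c : F) = 1 := by
    rw [← Units.coe_star, hc, Units.mul_inv]
  -- For `w = z + c τ(z)`, the relation `c τ(c) = 1` gives `c τ(w) = w`.
  have key : ∀ z : F, z + c * star z ≠ 0 → ∃ x, divStar F x = c := by
    intro z hz
    refine ⟨Units.mk0 _ hz, ?_⟩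
    rw [divStar_apply, mul_inv_eq_iff_eq_mul]
    ext
    simp only [Units.val_mk0, Units.val_mul, Units.coe_star, star_add, star_mul', star_star,
      mul_add, ← mul_assoc, hc', one_mul]
    ring
  by_cases h1 : (1 : F) + c * star 1 = 0
  · refine key d fun h2 => hd ?_
    have h3 : (c : F) = -1 := by
      rw [star_one, mul_one] at h1
      exact (eq_neg_of_add_eq_zero_right h1)
    rw [h3, neg_one_mul, ← sub_eq_add_neg, sub_eq_zero] at h2
    exact h2.symm
  · exact key 1 h1

end InvolutiveField

/-! ### The involution on units and the unitary Whitehead group. -/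

section Unitary

variable {Γ : Type v} [AddCommGroup Γ] [DecidableEq Γ] {E : Type u} [Ring E]
  (𝒜 : Γ → AddSubgroup E) [GradedRing 𝒜]

/-- The inclusion of `T_0^*` in `E^*`. -/
def unitsInclusion : (centerZero 𝒜)ˣ →* Eˣ := Units.map (centerZero 𝒜).subtype.toMonoidHom

theorem unitsInclusion_injective : Function.Injective (unitsInclusion 𝒜) :=
  Units.map_injective Subtype.val_injective

theorem unitsInclusion_mem_center (t : (centerZero 𝒜)ˣ) :
    unitsInclusion 𝒜 t ∈ Subgroup.center Eˣ :=
  Subgroup.mem_center_iff.2 fun g =>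
    Units.ext (Subring.mem_center_iff.1 (t : centerZero 𝒜).2.1 g)

section Degree

variable [hE : IsGradedDivisionRing 𝒜] [IsAddTorsionFree Γ]

theorem degree_unitsInclusion (t : (centerZero 𝒜)ˣ) : degree 𝒜 (unitsInclusion 𝒜 t) = 1 :=
  (mem_zero_iff_degree 𝒜 _).1 (t : centerZero 𝒜).2.2

variable {𝒜} in
theorem IsTotallyRamified.exists_unitsInclusion_eq (h : IsTotallyRamified 𝒜) {u : Eˣ}
    (hu : degree 𝒜 u = 1) : ∃ t, unitsInclusion 𝒜 t = u := by
  have key : ∀ w : Eˣ, degree 𝒜 w = 1 → (w : E) ∈ centerZero 𝒜 := fun w hw =>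
    ⟨(unit_mem_center_iff 𝒜 w).1 (h.mem_center_of_degree hw), (mem_zero_iff_degree 𝒜 w).2 hw⟩
  exact ⟨⟨⟨u, key u hu⟩, ⟨(u⁻¹ : Eˣ), key u⁻¹ (by rw [map_inv, hu, inv_one])⟩,
    Subtype.ext u.mul_inv, Subtype.ext u.inv_mul⟩, Units.ext rfl⟩

variable {𝒜} in
theorem IsTotallyRamified.exists_pairing (h : IsTotallyRamified 𝒜) :
    ∃ β : Eˣ →* Eˣ →* (centerZero 𝒜)ˣ, ∀ u v, unitsInclusion 𝒜 (β u v) = ⁅u, v⁆ := by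
  refine exists_commutator_pairing (unitsInclusion_injective 𝒜) ?_ fun u v => ?_
  · rintro _ ⟨t, rfl⟩
    exact unitsInclusion_mem_center 𝒜 t
  · apply h.exists_unitsInclusion_eq
    rw [map_commutatorElement]
    exact commutatorElement_eq_one_iff_commute.2 (Commute.all _ _)

theorem unitsInclusion_mem_unitsNrdOne_iff (h : IsTotallyRamified 𝒜)
    [Module.Finite (Subring.center E) E] {n : ℕ}
    (hn : Module.finrank (Subring.center E) E = n ^ 2) (t : (centerZero 𝒜)ˣ) :
    unitsInclusion 𝒜 t ∈ unitsNrdOne 𝒜 ↔ t ∈ rootsOfUnity n (centerZero 𝒜) := by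
  refine (h.nrd_eq_one_iff hn _).trans ?_
  rw [and_iff_right (degree_unitsInclusion 𝒜 t), mem_rootsOfUnity, ← map_pow,
    ← map_one (unitsInclusion 𝒜), (unitsInclusion_injective 𝒜).eq_iff]

theorem exists_unitsInclusion_eq_of_mem_unitsNrdOne (h : IsTotallyRamified 𝒜)
    [Module.Finite (Subring.center E) E] {n : ℕ}
    (hn : Module.finrank (Subring.center E) E = n ^ 2) {u : Eˣ} (hu : u ∈ unitsNrdOne 𝒜) :
    ∃ t ∈ rootsOfUnity n (centerZero 𝒜), unitsInclusion 𝒜 t = u := by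
  obtain ⟨t, rfl⟩ := h.exists_unitsInclusion_eq ((h.nrd_eq_one_iff hn u).1 hu).1
  exact ⟨t, (unitsInclusion_mem_unitsNrdOne_iff 𝒜 h hn t).1 hu, rfl⟩

theorem SK1_mk_eq_iff (x y : unitsNrdOne 𝒜) :
    (QuotientGroup.mk x : SK1 𝒜) = QuotientGroup.mk y ↔
      (QuotientGroup.mk (x : Eˣ) : K1 E) = QuotientGroup.mk (y : Eˣ) := by
  rw [QuotientGroup.eq, QuotientGroup.eq, Subgroup.mem_subgroupOf]
  rfl

end Degree

theorem K1_mul_comm (x y : K1 E) : x * y = y * x :=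
  mul_comm (G := Abelianization Eˣ) x y

section Pairing

variable [IsGradedDivisionRing 𝒜] {β : Eˣ →* Eˣ →* (centerZero 𝒜)ˣ}
  (hβ : ∀ u v, unitsInclusion 𝒜 (β u v) = ⁅u, v⁆)

include hβ

theorem pairing_unitsInclusion_mul (t : (centerZero 𝒜)ˣ) (u : Eˣ) :
    β (unitsInclusion 𝒜 t * u) = β u := by
  have h1 : unitsInclusion 𝒜 t ∈ β.ker :=
    pairing_ker (unitsInclusion_injective 𝒜) hβ ▸ unitsInclusion_mem_center 𝒜 t
  rw [map_mul, MonoidHom.mem_ker.1 h1, one_mul]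

theorem unitsInclusion_mem_commutator_iff [Finite (Eˣ ⧸ Subgroup.center Eˣ)] (t : (centerZero 𝒜)ˣ) :
    unitsInclusion 𝒜 t ∈ commutator Eˣ ↔
      t ∈ rootsOfUnity (Monoid.exponent (Eˣ ⧸ Subgroup.center Eˣ)) (centerZero 𝒜) := by
  rw [commutator_eq_map_rootsOfUnity (unitsInclusion_injective 𝒜) hβ,
    Subgroup.mem_map_iff_mem (unitsInclusion_injective 𝒜)]

end Pairing

variable [StarRing E]

variable (E) in
/-- The homomorphism `E^* → K_1(E)` given by `a ↦ a^(1-τ)`. -/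
def unitsToK1 : Eˣ →* K1 E where
  toFun a := QuotientGroup.mk (oneSubTau a)
  map_one' := by simp [oneSubTau]
  map_mul' a b := by
    simp only [oneSubTau, star_mul, mul_inv_rev, QuotientGroup.mk_mul]
    have key : ∀ w x y z : K1 E, w * x * (y * z) = w * y * (x * z) := fun w x y z => by
      rw [mul_assoc, mul_assoc, ← mul_assoc x, ← mul_assoc y, K1_mul_comm x y]
    exact key _ _ _ _

theorem unitsToK1_apply (a : Eˣ) : unitsToK1 E a = QuotientGroup.mk (oneSubTau a) := rfl

theorem symmUnitsCommutator_le_ker : symmUnitsCommutator E ≤ (unitsToK1 E).ker := by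
  refine sup_le ((Subgroup.closure_le _).2 fun a ha => ?_) ?_
  · have ha : star a = a := ha
    rw [SetLike.mem_coe, MonoidHom.mem_ker, unitsToK1_apply, oneSubTau, ha, mul_inv_cancel,
      QuotientGroup.mk_one]
  · refine Subgroup.commutator_le.2 fun a _ b _ => ?_
    rw [MonoidHom.mem_ker, map_commutatorElement, commutatorElement_eq_one_iff_mul_comm]
    exact K1_mul_comm _ _

variable [IsGradedInvolution 𝒜]

theorem star_unitsInclusion (t : (centerZero 𝒜)ˣ) :
    star (unitsInclusion 𝒜 t) = unitsInclusion 𝒜 (star t) := Units.ext rfl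

variable [hE : IsGradedDivisionRing 𝒜]

theorem oneSubTau_unitsInclusion (t : (centerZero 𝒜)ˣ) :
    oneSubTau (unitsInclusion 𝒜 t) = unitsInclusion 𝒜 (divStar _ t) := by
  rw [oneSubTau, star_unitsInclusion, ← map_inv, ← map_mul, divStar_apply]

theorem oneSubTau_unitsInclusion_mul (t : (centerZero 𝒜)ˣ) {s : Eˣ} (hs : star s = s) :
    oneSubTau (unitsInclusion 𝒜 t * s) = unitsInclusion 𝒜 (divStar _ t) := by
  have h1 : s * unitsInclusion 𝒜 (star t) = unitsInclusion 𝒜 (star t) * s :=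
    Subgroup.mem_center_iff.1 (unitsInclusion_mem_center 𝒜 _) s
  rw [oneSubTau, star_mul, hs, star_unitsInclusion, h1, mul_inv_rev, mul_assoc,
    mul_inv_cancel_left, ← map_inv, ← map_mul, divStar_apply]

theorem divStar_mem_rootsOfUnity_iff (k : ℕ) (t : (centerZero 𝒜)ˣ) :
    divStar _ t ∈ rootsOfUnity k (centerZero 𝒜) ↔ t ∈ powFixed 𝒜 k := by
  rw [mem_rootsOfUnity, ← map_pow, divStar_eq_one_iff, Units.ext_iff]
  rfl

theorem adjoin_eq_top_of_star_ne {S : Set (centerZero 𝒜)} {ζ : centerZero 𝒜} (hζ : ζ ∈ S)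
    (hne : star ζ ≠ ζ) : IntermediateField.adjoin (fixedZero 𝒜) S = ⊤ := by
  rw [eq_top_iff]
  rintro x -
  have h0 : ζ - star ζ ≠ 0 := sub_ne_zero.2 hne.symm
  -- Obtained by solving `x = a + b * ζ` together with its image under `τ`, for fixed `a` and `b`.
  let b := (x - star x) / (ζ - star ζ)
  have hb : star b = b := by
    rw [star_div₀, star_sub, star_sub, star_star, star_star, ← neg_sub, ← neg_sub ζ, neg_div_neg_eq]
  have hbx : b * (ζ - star ζ) = x - star x := div_mul_cancel₀ _ h0
  have ha : star (x - b * ζ) = x - b * ζ := by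
    rw [star_sub, star_mul', hb]
    linear_combination hbx
  have hfix : ∀ y : centerZero 𝒜, star y = y → y ∈ IntermediateField.adjoin (fixedZero 𝒜) S :=
    fun y hy => (IntermediateField.adjoin (fixedZero 𝒜) S).algebraMap_mem ⟨y, hy⟩
  have := add_mem (hfix _ ha) (mul_mem (hfix b hb) (IntermediateField.subset_adjoin _ S hζ))
  simpa using this

variable [IsAddTorsionFree Γ]

theorem degree_star (u : Eˣ) : degree 𝒜 (star u) = degree 𝒜 u :=
  (mem_iff_degree 𝒜 (star u) (degree 𝒜 u).toAdd).1
    (IsGradedInvolution.star_mem ((mem_iff_degree 𝒜 u _).2 rfl))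

/-- By `Γ_T = Γ_R`, each homogeneous component of a central element is a `T_0`-multiple of a
symmetric central unit. If `τ` were trivial on `T_0`, it would be trivial on `T`. -/
theorem exists_star_ne (hτ : IsUnitaryInvolution E) (hT : CenterIsUnramified 𝒜) :
    ∃ d : centerZero 𝒜, star d ≠ d := by
  classical
  by_contra! hall
  obtain ⟨t, ht, hne⟩ := hτ
  apply hne
  rw [← DirectSum.sum_support_decompose 𝒜 t, star_sum]
  refine Finset.sum_congr rfl fun γ hγ => ?_
  have ha : ((DirectSum.decompose 𝒜 t) γ : E) ≠ 0 := by simpa using hγ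
  have hac := decompose_mem_center 𝒜 ht γ
  set a : E := ((DirectSum.decompose 𝒜 t) γ : E)
  have hmem : γ ∈ gradeSet 𝒜 (Subring.center E : Set E) := ⟨a, hac, ha, SetLike.coe_mem _⟩
  rw [hT] at hmem
  obtain ⟨r, ⟨hrc, hrs⟩, hr0, hr⟩ := hmem
  obtain ⟨r, rfl⟩ := hE.isUnit_of_mem hr hr0
  have hinv : ((r⁻¹ : Eˣ) : E) ∈ Subring.center E :=
    (unit_mem_center_iff 𝒜 _).1 (inv_mem ((unit_mem_center_iff 𝒜 r).2 hrc))
  have hdeg : ((r⁻¹ : Eˣ) : E) ∈ 𝒜 (-γ) := by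
    rw [mem_iff_degree, map_inv, (mem_iff_degree 𝒜 r γ).1 hr, ofAdd_neg]
  have h0 : a * ((r⁻¹ : Eˣ) : E) ∈ centerZero 𝒜 := by
    refine ⟨mul_mem hac hinv, ?_⟩
    have := SetLike.GradedMul.mul_mem (A := 𝒜) (show a ∈ 𝒜 γ from SetLike.coe_mem _) hdeg
    rwa [add_neg_cancel] at this
  have h1 : star (a * ((r⁻¹ : Eˣ) : E)) = a * ((r⁻¹ : Eˣ) : E) :=
    congrArg Subtype.val (hall ⟨_, h0⟩)
  have h2 : a = a * ((r⁻¹ : Eˣ) : E) * r := by rw [mul_assoc, Units.inv_mul, mul_one]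
  rw [h2, star_mul, hrs, h1]
  exact (Subring.mem_center_iff.1 hrc _).symm

variable {d : centerZero 𝒜} (hd : star d ≠ d) (h : IsTotallyRamified 𝒜)

include hd h

/-- The quotient `c = τ(u) u⁻¹` has degree zero, so it lies in `T_0^*`, and `τ² = id` gives `c τ(c)
= 1`. Writing `c = x τ(x)⁻¹` by Hilbert 90 makes `x * u` symmetric. -/
theorem exists_eq_unitsInclusion_mul_symm (u : Eˣ) :
    ∃ t s, star s = s ∧ unitsInclusion 𝒜 t * s = u := by
  obtain ⟨c, hc⟩ := h.exists_unitsInclusion_eq (u := star u * u⁻¹)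
    (by rw [map_mul, map_inv, degree_star, mul_inv_cancel])
  have hcu : star u = unitsInclusion 𝒜 c * u := by rw [hc, inv_mul_cancel_right]
  have hcomm : ∀ t, u * unitsInclusion 𝒜 t = unitsInclusion 𝒜 t * u := fun t =>
    Subgroup.mem_center_iff.1 (unitsInclusion_mem_center 𝒜 t) u
  have h1 : unitsInclusion 𝒜 (c * star c) * u = u := by
    conv_rhs => rw [← star_star u, hcu, star_mul, star_unitsInclusion, hcu, mul_assoc, hcomm]
    rw [map_mul, mul_assoc]
  have h2 : c * star c = 1 :=
    unitsInclusion_injective 𝒜 (by rw [map_one]; exact mul_eq_right.1 h1)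
  obtain ⟨x, rfl⟩ := exists_divStar_eq hd (eq_inv_of_mul_eq_one_right h2)
  refine ⟨x⁻¹, unitsInclusion 𝒜 x * u, ?_, ?_⟩
  · rw [star_mul, star_unitsInclusion, hcu, mul_assoc, hcomm, ← mul_assoc, ← map_mul,
      divStar_apply, inv_mul_cancel_right]
  · rw [← mul_assoc, ← map_mul, inv_mul_cancel, map_one, one_mul]

variable {β : Eˣ →* Eˣ →* (centerZero 𝒜)ˣ} (hβ : ∀ u v, unitsInclusion 𝒜 (β u v) = ⁅u, v⁆)

include hβ

/-- Every value of the commutator pairing is attained on symmetric units. -/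
theorem exists_symm_pairing_eq (u v : Eˣ) :
    ∃ r s, star r = r ∧ star s = s ∧ β r s = β u v := by
  obtain ⟨x, r, hr, rfl⟩ := exists_eq_unitsInclusion_mul_symm 𝒜 hd h u
  obtain ⟨y, s, hs, rfl⟩ := exists_eq_unitsInclusion_mul_symm 𝒜 hd h v
  refine ⟨r, s, hr, hs, ?_⟩
  rw [pairing_unitsInclusion_mul 𝒜 hβ, pairing_swap (unitsInclusion_injective 𝒜) hβ s r,
    pairing_swap (unitsInclusion_injective 𝒜) hβ (_ * s) r, pairing_unitsInclusion_mul 𝒜 hβ]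

/-- For symmetric `r` and `s`, `τ` sends `⁅r, s⁆` to `⁅s⁻¹, r⁻¹⁆`, whose pairing value is `β s r`.
-/
theorem star_pairing (u v : Eˣ) : star (β u v) = (β u v)⁻¹ := by
  obtain ⟨r, s, hr, hs, hrs⟩ := exists_symm_pairing_eq 𝒜 hd h hβ u v
  rw [← hrs, ← pairing_swap (unitsInclusion_injective 𝒜) hβ]
  apply unitsInclusion_injective 𝒜
  have h1 : β s r = β s⁻¹ r⁻¹ := by simp
  rw [← star_unitsInclusion, h1, hβ, hβ]
  simp [commutatorElement_def, star_mul, star_inv, hr, hs, mul_assoc]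

section Finite

variable [Finite (Eˣ ⧸ Subgroup.center Eˣ)]

theorem star_eq_inv_of_mem_rootsOfUnity {ω : (centerZero 𝒜)ˣ}
    (hω : ω ∈ rootsOfUnity (Monoid.exponent (Eˣ ⧸ Subgroup.center Eˣ)) (centerZero 𝒜)) :
    star ω = ω⁻¹ := by
  obtain ⟨u, v, rfl⟩ :=
    exists_pairing_eq_of_mem_rootsOfUnity (unitsInclusion_injective 𝒜) hβ hω
  exact star_pairing 𝒜 hd h hβ u v

/-- Here `t^(1-τ)` is a commutator `⁅r, s⁆` of symmetric units, which equals `(r * s)^(1-τ)`.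
Writing `r * s = y * x` with `x` symmetric and `y ∈ T_0^*` gives `y^(1-τ) = t^(1-τ)`. So `t * y⁻¹`
is symmetric, and `y = r * s * x⁻¹` lies in `Σ_τ`. -/
theorem unitsInclusion_mem_symmUnits {t : (centerZero 𝒜)ˣ}
    (ht : t ∈ powFixed 𝒜 (Monoid.exponent (Eˣ ⧸ Subgroup.center Eˣ))) :
    unitsInclusion 𝒜 t ∈ symmUnits E := by
  rw [← divStar_mem_rootsOfUnity_iff] at ht
  obtain ⟨u, v, huv⟩ :=
    exists_pairing_eq_of_mem_rootsOfUnity (unitsInclusion_injective 𝒜) hβ ht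
  obtain ⟨r, s, hr, hs, hrs⟩ := exists_symm_pairing_eq 𝒜 hd h hβ u v
  obtain ⟨y, x, hx, hyx⟩ := exists_eq_unitsInclusion_mul_symm 𝒜 hd h (r * s)
  have h1 : divStar _ y = divStar _ t := by
    apply unitsInclusion_injective 𝒜
    rw [← huv, ← hrs, hβ, ← oneSubTau_unitsInclusion_mul 𝒜 y hx, hyx,
      oneSubTau, star_mul, hr, hs, commutatorElement_def, mul_inv_rev]
    simp only [mul_assoc]
  have h2 : star (t * y⁻¹) = t * y⁻¹ := by
    rw [← divStar_eq_one_iff, map_mul, map_inv, h1, mul_inv_cancel]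
  have hmem : ∀ {a : Eˣ}, star a = a → a ∈ symmUnits E := fun ha => Subgroup.subset_closure ha
  have h3 : unitsInclusion 𝒜 y ∈ symmUnits E := by
    rw [eq_mul_inv_of_mul_eq hyx]
    exact mul_mem (mul_mem (hmem hr) (hmem hs)) (inv_mem (hmem hx))
  have h4 : unitsInclusion 𝒜 (t * y⁻¹) ∈ symmUnits E :=
    hmem (by rw [star_unitsInclusion, h2])
  simpa using mul_mem h4 h3

theorem unitsInclusion_mem_symmUnitsCommutator_iff (t : (centerZero 𝒜)ˣ) :
    unitsInclusion 𝒜 t ∈ symmUnitsCommutator E ↔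
      t ∈ powFixed 𝒜 (Monoid.exponent (Eˣ ⧸ Subgroup.center Eˣ)) := by
  refine ⟨fun ht => ?_, fun ht => Subgroup.mem_sup_left
    (unitsInclusion_mem_symmUnits 𝒜 hd h hβ ht)⟩
  have h1 := symmUnitsCommutator_le_ker ht
  rwa [MonoidHom.mem_ker, unitsToK1_apply, QuotientGroup.eq_one_iff, oneSubTau_unitsInclusion,
    unitsInclusion_mem_commutator_iff 𝒜 hβ, divStar_mem_rootsOfUnity_iff] at h1

/-- This is the injectivity of `α`: a symmetric factor does not affect `a^(1-τ)`, so only the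
`T_0^*` part of `a` matters. -/
theorem mem_symmUnitsCommutator_of_oneSubTau_mem {a : Eˣ} (ha : oneSubTau a ∈ commutator Eˣ) :
    a ∈ symmUnitsCommutator E := by
  obtain ⟨t, s, hs, rfl⟩ := exists_eq_unitsInclusion_mul_symm 𝒜 hd h a
  rw [oneSubTau_unitsInclusion_mul 𝒜 t hs,
    unitsInclusion_mem_commutator_iff 𝒜 hβ, divStar_mem_rootsOfUnity_iff] at ha
  exact mul_mem ((unitsInclusion_mem_symmUnitsCommutator_iff 𝒜 hd h hβ t).2 ha)
    (Subgroup.mem_sup_left (Subgroup.subset_closure hs))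

/-- If `η = ω τ(ω)` were nontrivial, a power of it would have prime order `p ∣ n`. Then `p` divides
`|E^*/Z(E^*)| = n²`, hence the exponent, so that power is both fixed and inverted by `τ`. This
forces `p = 2`, against oddness. -/
theorem mul_star_eq_one_of_odd_exponent {n : ℕ}
    (hn : Nat.card (Eˣ ⧸ Subgroup.center Eˣ) = n ^ 2)
    (hodd : Odd (Monoid.exponent (Eˣ ⧸ Subgroup.center Eˣ))) {ω : (centerZero 𝒜)ˣ}
    (hω : ω ∈ rootsOfUnity n (centerZero 𝒜)) : ω * star ω = 1 := by
  by_contra hne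
  set η := ω * star ω with hη
  have hηn : η ^ n = 1 := by
    rw [hη, mul_pow, ← star_pow, (mem_rootsOfUnity _ _).1 hω, star_one, one_mul]
  have hηs : star η = η := by rw [hη, star_mul', star_star, mul_comm]
  obtain ⟨p, hp, hpd⟩ := Nat.exists_prime_and_dvd (mt orderOf_eq_one_iff.1 hne)
  have hpe : p ∣ Monoid.exponent (Eˣ ⧸ Subgroup.center Eˣ) :=
    prime_dvd_exponent_of_dvd_card hp
      (hn ▸ (hpd.trans (orderOf_dvd_of_pow_eq_one hηn)).trans (dvd_pow_self n two_ne_zero))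
  have hn0 : n ≠ 0 := by
    rintro rfl
    exact Nat.card_pos.ne' (hn.trans (by simp))
  have hord : orderOf (η ^ (orderOf η / p)) = p := by
    refine orderOf_pow_orderOf_div ?_ hpd
    rintro h0
    exact hn0 (Nat.eq_zero_of_zero_dvd (h0 ▸ orderOf_dvd_of_pow_eq_one hηn))
  have h1 : star (η ^ (orderOf η / p)) = (η ^ (orderOf η / p))⁻¹ :=
    star_eq_inv_of_mem_rootsOfUnity 𝒜 hd h hβ
      ((mem_rootsOfUnity _ _).2 (orderOf_dvd_iff_pow_eq_one.1 (hord.symm ▸ hpe)))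
  rw [star_pow, hηs, eq_inv_iff_mul_eq_one, ← sq] at h1
  have h2 : p ∣ 2 := hord ▸ orderOf_dvd_of_pow_eq_one h1
  rw [(Nat.prime_dvd_prime_iff_eq hp Nat.prime_two).1 h2] at hpe
  exact (Nat.not_even_iff_odd.2 hodd) (even_iff_two_dvd.2 hpe)

end Finite

end Unitary

end GradedSK

end

/-! ### The main theorem. -/

open GradedSK in
theorem theorem5p1 {Γ : Type v} [AddCommGroup Γ] [DecidableEq Γ] [IsAddTorsionFree Γ]
    {E : Type u} [Ring E] (𝒜 : Γ → AddSubgroup E) [GradedRing 𝒜] [IsGradedDivisionRing 𝒜]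
    [Module.Finite (Subring.center E) E]
    [StarRing E] [IsGradedInvolution 𝒜] (hτ : IsUnitaryInvolution E)
    (n : ℕ) (hn : Module.finrank (Subring.center E) E = n ^ 2)
    (hE : IsTotallyRamified 𝒜) (hT : CenterIsUnramified 𝒜)
    (e : ℕ) (he : AddMonoid.exponent (RelativeGradeGroup 𝒜) = e) :
    -- `{a ∈ T_0^* | a^e ∈ R_0^*} ⊆ {a ∈ T_0^* | a^n ∈ R_0^*}`, and the first isomorphism
    powFixed 𝒜 e ≤ powFixed 𝒜 n ∧
    Nonempty (UnitarySK1 𝒜 ≃* powFixed 𝒜 n ⧸ (powFixed 𝒜 e).subgroupOf (powFixed 𝒜 n)) ∧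
    -- `T_0` contains all `e`-th roots of unity, `μ_e ⊆ {ω ∈ μ_n(T_0) | τ(ω) = ω⁻¹}`,
    -- and the second isomorphism
    (Polynomial.X ^ e - 1 : (centerZero 𝒜)[X]).Splits ∧
    rootsOfUnity e (centerZero 𝒜) ≤ invertedRoots 𝒜 n ∧
    Nonempty (UnitarySK1 𝒜 ≃* invertedRoots 𝒜 n ⧸
      (rootsOfUnity e (centerZero 𝒜)).subgroupOf (invertedRoots 𝒜 n)) ∧
    -- the description of `SK_1(E)`
    Nonempty (SK1 𝒜 ≃* rootsOfUnity n (centerZero 𝒜) ⧸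
      (rootsOfUnity e (centerZero 𝒜)).subgroupOf (rootsOfUnity n (centerZero 𝒜))) ∧
    -- the map `K_1(E, τ) → K_1(E)` given by `a ↦ a^(1-τ)` and its restriction `α`
    (∃ κ : UnitaryK1 E →* K1 E, ∃ α : UnitarySK1 𝒜 →* SK1 𝒜,
      (∀ a : Eˣ, κ (QuotientGroup.mk a) = QuotientGroup.mk (oneSubTau a)) ∧
      (∀ a : unitarySigma' 𝒜, α (QuotientGroup.mk a) =
        QuotientGroup.mk ⟨oneSubTau (a : Eˣ), oneSubTau_mem 𝒜 a⟩) ∧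
      Function.Injective α ∧
      (Odd e → Function.Bijective α)) ∧
    -- the case `e > 2`
    (2 < e →
      IntermediateField.adjoin (fixedZero 𝒜) {ω : centerZero 𝒜 | ω ^ e = 1} = ⊤ ∧
      ∀ ω ∈ rootsOfUnity e (centerZero 𝒜), star ω = ω⁻¹) := by
  have hfin := hE.finite_quotient_center
  have hcard := hE.card_quotient_center.trans hn
  obtain rfl : Monoid.exponent (Eˣ ⧸ Subgroup.center Eˣ) = e :=
    hE.exponent_quotient_center.trans he
  obtain ⟨d, hd⟩ := exists_star_ne 𝒜 hτ hT
  obtain ⟨β, hβ⟩ := hE.exists_pairing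
  have hι := unitsInclusion_injective 𝒜
  obtain ⟨ζ, hζ⟩ : ∃ ζ : (centerZero 𝒜)ˣ,
      IsPrimitiveRoot ζ (Monoid.exponent (Eˣ ⧸ Subgroup.center Eˣ)) := by
    obtain ⟨u, v, huv⟩ := exists_pairing_isPrimitiveRoot hι hβ
    exact ⟨_, huv⟩
  have hdvd := exponent_dvd_of_card_eq_sq hι hβ hcard
  have hstar : ∀ ω ∈ rootsOfUnity (Monoid.exponent (Eˣ ⧸ Subgroup.center Eˣ)) (centerZero 𝒜),
      star ω = ω⁻¹ := fun ω hω => star_eq_inv_of_mem_rootsOfUnity 𝒜 hd hE hβ hω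
  have hroots : rootsOfUnity (Monoid.exponent (Eˣ ⧸ Subgroup.center Eˣ)) (centerZero 𝒜) ≤
      rootsOfUnity n (centerZero 𝒜) := rootsOfUnity_le_of_dvd hdvd
  have hSigma : ∀ t : (centerZero 𝒜)ˣ,
      unitsInclusion 𝒜 t ∈ unitarySigma' 𝒜 ↔ t ∈ powFixed 𝒜 n := by
    intro t
    rw [← divStar_mem_rootsOfUnity_iff, ← unitsInclusion_mem_unitsNrdOne_iff 𝒜 hE hn,
      ← oneSubTau_unitsInclusion]
    rfl
  obtain ⟨f⟩ : Nonempty (powFixed 𝒜 n ⧸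
      (powFixed 𝒜 (Monoid.exponent (Eˣ ⧸ Subgroup.center Eˣ))).subgroupOf (powFixed 𝒜 n) ≃*
      UnitarySK1 𝒜) := by
    refine nonempty_quotient_mulEquiv (unitsInclusion 𝒜) (fun t ht => (hSigma t).2 ht)
      (fun t _ => unitsInclusion_mem_symmUnitsCommutator_iff 𝒜 hd hE hβ t) fun a ha => ?_
    obtain ⟨t, s, hs, rfl⟩ := exists_eq_unitsInclusion_mul_symm 𝒜 hd hE a
    refine ⟨t, (hSigma t).1 ?_, ?_⟩
    · change oneSubTau (unitsInclusion 𝒜 t * s) ∈ unitsNrdOne 𝒜 at ha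
      rw [oneSubTau_unitsInclusion_mul 𝒜 t hs, ← oneSubTau_unitsInclusion] at ha
      exact ha
    · rw [inv_mul_cancel_left]
      exact Subgroup.mem_sup_left (Subgroup.subset_closure hs)
  obtain ⟨g⟩ : Nonempty (powFixed 𝒜 n ⧸
      (powFixed 𝒜 (Monoid.exponent (Eˣ ⧸ Subgroup.center Eˣ))).subgroupOf (powFixed 𝒜 n) ≃*
      invertedRoots 𝒜 n ⧸
        (rootsOfUnity (Monoid.exponent (Eˣ ⧸ Subgroup.center Eˣ)) (centerZero 𝒜)).subgroupOf
          (invertedRoots 𝒜 n)) := by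
    refine nonempty_quotient_mulEquiv (divStar (centerZero 𝒜))
      (fun t ht => ⟨(divStar_mem_rootsOfUnity_iff 𝒜 n t).2 ht,
        star_divStar (F := centerZero 𝒜) t⟩)
      (fun t _ => divStar_mem_rootsOfUnity_iff 𝒜 _ t) fun ω hω => ?_
    obtain ⟨x, rfl⟩ := exists_divStar_eq (F := centerZero 𝒜) hd (c := ω) hω.2
    exact ⟨x, (divStar_mem_rootsOfUnity_iff 𝒜 n x).1 hω.1, by simp⟩
  obtain ⟨k⟩ : Nonempty (rootsOfUnity n (centerZero 𝒜) ⧸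
      (rootsOfUnity (Monoid.exponent (Eˣ ⧸ Subgroup.center Eˣ)) (centerZero 𝒜)).subgroupOf
        (rootsOfUnity n (centerZero 𝒜)) ≃* SK1 𝒜) := by
    refine nonempty_quotient_mulEquiv (unitsInclusion 𝒜)
      (fun t ht => (unitsInclusion_mem_unitsNrdOne_iff 𝒜 hE hn t).2 ht)
      (fun t _ => unitsInclusion_mem_commutator_iff 𝒜 hβ t) fun a ha => ?_
    obtain ⟨t, ht, rfl⟩ := exists_unitsInclusion_eq_of_mem_unitsNrdOne 𝒜 hE hn ha
    exact ⟨t, ht, by simp⟩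
  refine ⟨fun t ht => ?_, ⟨f.symm⟩, ?_, fun ω hω => ⟨hroots hω, hstar ω hω⟩, ⟨f.symm.trans g⟩,
    ⟨k.symm⟩, ?_, fun he2 => ⟨?_, hstar⟩⟩
  · rw [← divStar_mem_rootsOfUnity_iff] at ht ⊢
    exact hroots ht
  · have h1 := X_pow_sub_C_splits_of_isPrimitiveRoot (IsPrimitiveRoot.coe_units_iff.2 hζ)
      (one_pow (Monoid.exponent (Eˣ ⧸ Subgroup.center Eˣ)))
    rwa [map_one] at h1
  · let α₀ : unitarySigma' 𝒜 →* SK1 𝒜 := MonoidHom.mk'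
      (fun a => QuotientGroup.mk ⟨oneSubTau (a : Eˣ), oneSubTau_mem 𝒜 a⟩) fun a b => by
        rw [← QuotientGroup.mk_mul, SK1_mk_eq_iff]
        exact map_mul (unitsToK1 E) (a : Eˣ) (b : Eˣ)
    have hα₀ : ∀ a, α₀ a = 1 ↔ oneSubTau (a : Eˣ) ∈ commutator Eˣ := fun a =>
      (QuotientGroup.eq_one_iff _).trans Subgroup.mem_subgroupOf
    have hle : (symmUnitsCommutator E).subgroupOf (unitarySigma' 𝒜) ≤ α₀.ker := by
      intro a ha
      rw [MonoidHom.mem_ker, hα₀, ← QuotientGroup.eq_one_iff]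
      exact symmUnitsCommutator_le_ker (Subgroup.mem_subgroupOf.1 ha)
    let α : UnitarySK1 𝒜 →* SK1 𝒜 := QuotientGroup.lift _ α₀ hle
    have hinj : Function.Injective α := by
      rw [injective_iff_map_eq_one]
      intro x hx
      obtain ⟨a, rfl⟩ := QuotientGroup.mk_surjective x
      rw [QuotientGroup.eq_one_iff, Subgroup.mem_subgroupOf]
      exact mem_symmUnitsCommutator_of_oneSubTau_mem 𝒜 hd hE hβ ((hα₀ a).1 hx)
    refine ⟨QuotientGroup.lift _ (unitsToK1 E) symmUnitsCommutator_le_ker, α, fun _ => rfl,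
      fun _ => rfl, hinj, fun hodd => ⟨hinj, fun x => ?_⟩⟩
    obtain ⟨⟨b, hb⟩, rfl⟩ := QuotientGroup.mk_surjective x
    obtain ⟨ω, hω, rfl⟩ := exists_unitsInclusion_eq_of_mem_unitsNrdOne 𝒜 hE hn hb
    -- For odd `e` every `n`-th root of unity in `T_0` is inverted by `τ`, so Hilbert 90 gives it a
    -- preimage under `t ↦ t^(1-τ)`.
    obtain ⟨y, rfl⟩ := exists_divStar_eq hd (eq_inv_of_mul_eq_one_right
      (mul_star_eq_one_of_odd_exponent 𝒜 hd hE hβ hcard hodd hω))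
    refine ⟨QuotientGroup.mk ⟨unitsInclusion 𝒜 y,
      (hSigma y).2 ((divStar_mem_rootsOfUnity_iff 𝒜 n y).1 hω)⟩, ?_⟩
    exact congrArg QuotientGroup.mk (Subtype.ext (oneSubTau_unitsInclusion 𝒜 y))
  -- A primitive `e`-th root is inverted by `τ`; were it also fixed, its order `e` would divide `2`.
  · refine adjoin_eq_top_of_star_ne 𝒜 (ζ := ζ)
      (by simpa using congrArg Units.val hζ.pow_eq_one) fun h1 => ?_
    have h2 : ζ = ζ⁻¹ := by
      rw [← hstar ζ ((mem_rootsOfUnity _ _).2 hζ.pow_eq_one)]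
      exact (Units.ext h1).symm
    rw [eq_inv_iff_mul_eq_one, ← sq] at h2
    exact absurd (Nat.le_of_dvd two_pos (hζ.dvd_of_pow_eq_one 2 h2)) (not_le.2 he2)
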